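/- Let $p=p^{(d)}$ be the standard Gaussian density on $\mathbb{R}^d$, with exact score $s=\nabla\log p$, and let $C:\mathbb{R}^d\times\mathbb{R}^d\to\mathbb{R}_+$ be any function with $\max_{u\in[0,1]}|\langle s(x+u(y-x)),\,y-x\rangle|\le C(x,y)$ for all $x,y\in\mathbb{R}^d$. For a step size $h>0$, the Barker-adjusted Langevin corrector moves from a state $x$ as follows. It proposes $y=x+\tfrac h2 s(x)+\sqrt h\,z$ with $z\sim\mathcal N(0,I_d)$. With $q(\cdot\mid x)$ the density of $\mathcal N(x+\tfrac h2 s(x),hI_d)$ and $H=q(x\mid y)/q(y\mid x)$, it then decides whether to accept by the two-coin algorithm, which repeats independent rounds until one of them returns a decision. In each round: with probability $(1+He^{C(x,y)})^{-1}$ return REJECT; otherwise draw $N\sim\mathrm{Poisson}(2C(x,y))$ and independent $R_1,\dots,R_N\sim\mathcal U([0,1])$, set $W=\prod_{j=1}^N\bigl(\tfrac12+\tfrac{\langle s(x+R_j(y-x)),\,y-x\rangle}{2C(x,y)}\bigr)$, and return ACCEPT with probability $W$; if nothing is returned, go to the next round. The next state is $y$ after ACCEPT and $x$ otherwise. Let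 $\mathrm{ESJD}_d(h)=\mathbb E\|X^{(i+1)}-X^{(i)}\|^2$ be the expected squared jumping distance of this chain in stationarity, $X^{(i)}\sim p$, and let $A_d(h)$ be the probability, in stationarity, that the proposal is accepted. Then for every $d$ the function $\mathrm{ESJD}_d$ attains its maximum over $h\in(0,\infty)$, and there are constants $c>0$ and $a$ with $|a-0.347|<0.0005$, independent of the choice of the functions $C$, such that for every choice of maximisers $h_d$ of $\mathrm{ESJD}_d$, $$\lim_{d\to\infty} d^{1/3}h_d=c,\qquad \lim_{d\to\infty}A_d(h_d)=a .$$ That is, the optimal step size scales as $h_d\sim c\,d^{-1/3}$, and the optimal expected acceptance rate converges to $0.347$ (to three decimal places). -/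

import Mathlib

open MeasureTheory ProbabilityTheory Filter Topology Set
open scoped ENNReal NNReal Gradient

namespace BarkerLangevin

/-- `ℝ^d` with the Euclidean norm. -/
abbrev Euc (d : ℕ) : Type := EuclideanSpace ℝ (Fin d)

/-- The density at `x` of the Gaussian law `N(m, v I)` on `ℝ^d`. -/
noncomputable def gaussianDensity {d : ℕ} (m : Euc d) (v : ℝ) (x : Euc d) : ℝ :=
  (2 * Real.pi * v) ^ (-(d : ℝ) / 2) * Real.exp (-‖x - m‖ ^ 2 / (2 * v))

/-- The law on `ℝ^d` with density `p`. -/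
noncomputable def lawOfDensity {d : ℕ} (p : Euc d → ℝ) : Measure (Euc d) :=
  volume.withDensity fun x => ENNReal.ofReal (p x)

/-- `s` is the exact score `∇ log p` of the density `p`. -/
def IsExactScore {d : ℕ} (p : Euc d → ℝ) (s : Euc d → Euc d) : Prop :=
  ∀ x, s x = ∇ (fun y => Real.log (p y)) x

/-- The unadjusted Langevin proposal `x + (h / 2) s(x) + √h z`. -/
noncomputable def proposal {d : ℕ} (s : Euc d → Euc d) (h : ℝ) (x z : Euc d) : Euc d :=
  x + (h / 2) • s x + Real.sqrt h • z

/-- The density `q(y | x)` of the proposal, that is of `N(x + (h / 2) s(x), h I)`. -/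
noncomputable def proposalDensity {d : ℕ} (s : Euc d → Euc d) (h : ℝ) (x y : Euc d) : ℝ :=
  gaussianDensity (x + (h / 2) • s x) h y

/-- The proposal ratio `H(x, y) = q(x | y) / q(y | x)`. -/
noncomputable def proposalRatio {d : ℕ} (s : Euc d → Euc d) (h : ℝ) (x y : Euc d) : ℝ :=
  proposalDensity s h y x / proposalDensity s h x y

/-- The integrand `⟨s(x + u (y - x)), y - x⟩` of the line integral of the score. -/
noncomputable def lineIntegrand {d : ℕ} (s : Euc d → Euc d) (x y : Euc d) (u : ℝ) : ℝ :=
  inner ℝ (s (x + u • (y - x))) (y - x)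

/-- `C` is a score bound: `max_{u ∈ [0, 1]} |⟨s(x + u (y - x)), y - x⟩| ≤ C(x, y)` for all
`x`, `y`. -/
def IsScoreBound {d : ℕ} (s : Euc d → Euc d) (C : Euc d → Euc d → ℝ) : Prop :=
  ∀ x y, ∀ u ∈ Icc (0 : ℝ) 1, |lineIntegrand s x y u| ≤ C x y

/-! ### The two-coin algorithm -/

/-- The uniform law on `[0, 1]`. -/
noncomputable def unif : Measure ℝ := volume.restrict (Icc 0 1)

instance : IsProbabilityMeasure unif := ⟨by simp [unif]⟩

/-- The random inputs `(U, N, (R₀, R₁, …), U')` of one round of the two-coin algorithm; only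
`R₀, …, R_{N - 1}` are used. -/
abbrev Round : Type := ℝ × ℕ × (ℕ → ℝ) × ℝ

/-- In a round with score bound `c`, the inputs are independent, `U`, `U'` and the `R_j` are uniform
on `[0, 1]`, and `N` is Poisson with mean `2 c`. -/
noncomputable def roundLaw (c : ℝ) : Measure Round :=
  unif.prod ((poissonMeasure (2 * c).toNNReal).prod
    ((Measure.infinitePi fun _ : ℕ => unif).prod unif))

instance (c : ℝ) : IsProbabilityMeasure (roundLaw c) := by
  unfold roundLaw; infer_instance

/-- The inputs of the successive rounds are independent copies of those of one round. -/
noncomputable def coinLaw (c : ℝ) : Measure (ℕ → Round) :=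
  Measure.infinitePi fun _ : ℕ => roundLaw c

section Algorithm

variable {d : ℕ} (s : Euc d → Euc d) (C : Euc d → Euc d → ℝ) (h : ℝ) (x y : Euc d)

/-- The probability `α' = (1 + H(x, y) exp C(x, y))⁻¹` of immediate rejection in a round. -/
noncomputable def rejectProb : ℝ := (1 + proposalRatio s h x y * Real.exp (C x y))⁻¹

/-- `W = ∏_{j < N} (1 / 2 + I_j / (2 C(x, y)))`, `I_j = ⟨s(x + R_j (y - x)), y - x⟩`. -/
noncomputable def weight (N : ℕ) (R : ℕ → ℝ) : ℝ :=
  ∏ j ∈ Finset.range N, (1 / 2 + lineIntegrand s x y (R j) / (2 * C x y))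

/-- The round returns REJECT: `U ≤ α'`. -/
def RoundRejects (r : Round) : Prop := r.1 ≤ rejectProb s C h x y

/-- The round returns ACCEPT: it does not return REJECT, and `U' ≤ W`. -/
def RoundAccepts (r : Round) : Prop :=
  ¬ RoundRejects s C h x y r ∧ r.2.2.2 ≤ weight s C x y r.2.1 r.2.2.1

/-- The two-coin algorithm with state `x` and proposal `y`, run on the round inputs `ω`, returns
ACCEPT: some round returns ACCEPT, and no earlier round returned anything. -/
def Accepts (ω : ℕ → Round) : Prop :=
  ∃ n, RoundAccepts s C h x y (ω n) ∧
    ∀ k < n, ¬ RoundRejects s C h x y (ω k) ∧ ¬ RoundAccepts s C h x y (ω k)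

open Classical in
/-- The next state of the chain: the proposal `y` if accepted, the current state `x` otherwise. -/
noncomputable def nextState (ω : ℕ → Round) : Euc d :=
  if Accepts s C h x y ω then y else x

end Algorithm

/-- The expected squared jumping distance `E ‖X^{(i+1)} - X^{(i)}‖²` of the chain with target
density `p`, score `s`, score bound `C` and step size `h`, started in stationarity, `X^{(i)} ∼ p`. -/
noncomputable def esjd {d : ℕ} (p : Euc d → ℝ) (s : Euc d → Euc d) (C : Euc d → Euc d → ℝ)
    (h : ℝ) : ℝ≥0∞ :=
  ∫⁻ x, ∫⁻ z, ∫⁻ ω, ENNReal.ofReal (‖nextState s C h x (proposal s h x z) ω - x‖ ^ 2)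
    ∂(coinLaw (C x (proposal s h x z))) ∂(stdGaussian (Euc d)) ∂(lawOfDensity p)

/-- The expected acceptance rate of the same chain in stationarity: the probability that the
two-coin algorithm accepts. -/
noncomputable def acceptanceRate {d : ℕ} (p : Euc d → ℝ) (s : Euc d → Euc d)
    (C : Euc d → Euc d → ℝ) (h : ℝ) : ℝ :=
  (∫⁻ x, ∫⁻ z, coinLaw (C x (proposal s h x z)) {ω | Accepts s C h x (proposal s h x z) ω}
    ∂(stdGaussian (Euc d)) ∂(lawOfDensity p)).toReal

/-- The step size `h > 0` maximises the expected squared jumping distance over all step sizes. -/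
def IsOptimalStep {d : ℕ} (p : Euc d → ℝ) (s : Euc d → Euc d) (C : Euc d → Euc d → ℝ)
    (h : ℝ) : Prop :=
  0 < h ∧ IsMaxOn (esjd p s C) (Ioi 0) h

/-- The standard Gaussian density on `ℝ^d`. -/
noncomputable def stdDensity (d : ℕ) : Euc d → ℝ := gaussianDensity 0 1

end BarkerLangevin

/-!
The chain is first freed from the algorithm, then from `C`. For the standard Gaussian the score is
`s x = -x`, the line integral of the score from `x` to `y` is `(‖x‖² - ‖y‖²) / 2 = log (p y / p x)`,
and averaging `W` over the uniform points and the Poisson count gives a coin with success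
probability `e^{-C} p y / p x` (`prob_coin`). A geometric series over the rounds then shows that the
algorithm accepts with Barker's probability `σ(R)`, `R = (h / 8) (‖x‖² - ‖y‖²)`, whatever `C` is
(`coinLaw_accepts`). Hence `ESJD_d(h) = E ‖y - x‖² σ(R)` and `A_d(h) = E σ(R)` for independent
standard Gaussians `x` and `z` (`esjd_eq`, `acceptanceRate_eq`).

Since `σ(R) ≤ e^{R/2} / 2`, a Gaussian integral bounds `ESJD_d(h)` by
`8 h d (1 + d h³ / 64)^{-1/2}` (`lintegral_jumpIntegrand_le`). So `ESJD_d` tends to `0` at `0` and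
at infinity and attains its maximum (`exists_isMaxOn_meanJump`), and the scaled maximisers
`ℓ = h d^{1/3}` stay bounded.

The log-ratio `R` is close in mean to `-2 β² - 2 β N` with `N` standard Gaussian and
`β = √(h³ d) / 8 = ℓ^{3/2} / 8`, because `‖x‖²` and `‖z‖²` concentrate at `d`. As `σ` is Lipschitz,
`A_d` is close to `G β = e^{-β²/2} K(β) / 2` with `K β = E (1 / cosh (β N))`, and `ESJD_d / d^{2/3}`
to the efficiency `ℓ G(ℓ^{3/2} / 8)`, uniformly for bounded `ℓ` (`abs_meanAccept_sub_le`,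
`abs_meanJump_sub_le`).

The derivative of the efficiency has the sign of `L / K - 1/3 - β²`, `L β = E (N² / cosh (β N))`.
Here `L / K`, the second moment of `N` under the weight `1 / cosh (β N)`, decreases by Chebyshev's
association inequality (`sechSecondMoment_mul_le`), so the efficiency is strictly unimodal with a
single maximiser `c`, and the scaled step sizes converge to it (`tendsto_of_isMaxOn`). It remains to
locate `c`: a polynomial `A` close to `1 / cosh` gives, through
`1 / q = 2 A - A² q + (1 - A q)² / q` with `q = cosh`, two-sided bounds for `K` and `L` by exact
Gaussian moments (`sech_moment_bounds`). They put the root `β` between `0.645` and `0.6467`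
(`slope_lo`, `slope_hi`), and the decreasing function `G` there between `0.3465` and `0.3475`
(`limitRate_lo`, `limitRate_hi`).
-/

namespace BarkerLangevin

/-! ### The two-coin algorithm -/

/-- In independent rounds with common law `μ`, the event `A` occurs strictly before the disjoint
event `B` does with probability `μ A / (μ A + μ B)`. -/
lemma infinitePi_first_mem {X : Type*} [MeasurableSpace X] (μ : Measure X) [IsProbabilityMeasure μ]
    {A B : Set X} (hA : MeasurableSet A) (hB : MeasurableSet B) (hAB : Disjoint A B) :
    MeasurableSet {ω : ℕ → X | ∃ n, ω n ∈ A ∧ ∀ k < n, ω k ∉ B ∧ ω k ∉ A} ∧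
    Measure.infinitePi (fun _ : ℕ => μ) {ω | ∃ n, ω n ∈ A ∧ ∀ k < n, ω k ∉ B ∧ ω k ∉ A}
      = μ A / (μ A + μ B) := by
  set t : ℕ → ℕ → Set X := fun n k => if k = n then A else (A ∪ B)ᶜ with ht
  have htm : ∀ n k, MeasurableSet (t n k) := by
    intro n k; simp only [ht]; split_ifs
    · exact hA
    · exact (hA.union hB).compl
  set E : ℕ → Set (ℕ → X) := fun n => Set.pi (Finset.range (n + 1)) (t n) with hE
  have hEm : ∀ n, MeasurableSet (E n) := fun n =>
    MeasurableSet.pi (Finset.countable_toSet _) fun k _ => htm n k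
  have hmem : ∀ n (ω : ℕ → X), ω ∈ E n ↔ ω n ∈ A ∧ ∀ k < n, ω k ∉ B ∧ ω k ∉ A := by
    intro n ω
    simp only [hE, Set.mem_pi, Finset.coe_range, Set.mem_Iio, ht]
    constructor
    · intro H
      refine ⟨by simpa using H n (Nat.lt_succ_self n), fun k hk => ?_⟩
      have := H k (by omega)
      rw [if_neg hk.ne] at this
      simpa [not_or, and_comm] using this
    · rintro ⟨h1, h2⟩ k hk
      split_ifs with h
      · exact h ▸ h1
      · simpa [not_or, and_comm] using h2 k (by omega)
  have hset : {ω : ℕ → X | ∃ n, ω n ∈ A ∧ ∀ k < n, ω k ∉ B ∧ ω k ∉ A} = ⋃ n, E n := by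
    ext ω; simp only [Set.mem_ofPred_eq, Set.mem_iUnion, hmem]
  have hdisj : Pairwise (Function.onFun Disjoint E) := by
    have key : ∀ m n, m < n → Disjoint (E m) (E n) := by
      intro m n hmn
      rw [Set.disjoint_left]
      intro ω h1 h2
      exact (((hmem n ω).1 h2).2 m hmn).2 ((hmem m ω).1 h1).1
    intro m n hmn
    rcases lt_or_gt_of_ne hmn with h | h
    · exact key m n h
    · exact (key n m h).symm
  refine ⟨hset ▸ MeasurableSet.iUnion hEm, ?_⟩
  rw [hset, measure_iUnion hdisj hEm]
  have hEn : ∀ n, Measure.infinitePi (fun _ : ℕ => μ) (E n) = μ (A ∪ B)ᶜ ^ n * μ A := by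
    intro n
    rw [hE, Measure.infinitePi_pi _ (fun k _ => htm n k), Finset.prod_range_succ]
    congr 1
    · rw [Finset.prod_congr rfl (g := fun _ => μ (A ∪ B)ᶜ)]
      · simp
      · intro k hk
        simp [ht, (Finset.mem_range.1 hk).ne]
    · simp [ht]
  simp_rw [hEn]
  rw [ENNReal.tsum_mul_right, ENNReal.tsum_geometric, prob_compl_eq_one_sub (hA.union hB),
    ENNReal.sub_sub_cancel ENNReal.one_ne_top prob_le_one, measure_union hAB hB, mul_comm,
    ENNReal.div_eq_inv_mul, mul_comm]

lemma unif_Iic {w : ℝ} (hw : w ∈ Icc (0 : ℝ) 1) : unif (Iic w) = ENNReal.ofReal w := by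
  have : Iic w ∩ Icc (0 : ℝ) 1 = Icc 0 w := by
    ext u
    simp only [Set.mem_inter_iff, Set.mem_Iic, Set.mem_Icc]
    constructor
    · rintro ⟨h1, h2, h3⟩; exact ⟨h2, h1⟩
    · rintro ⟨h1, h2⟩; exact ⟨h2, h1, h2.trans hw.2⟩
  rw [unif, Measure.restrict_apply measurableSet_Iic, this]
  simp

lemma lintegral_infinitePi_prod_range {X : Type*} [MeasurableSpace X] (μ : Measure X)
    [IsProbabilityMeasure μ] {f : X → ℝ≥0∞} (hf : Measurable f) (n : ℕ) :
    ∫⁻ R, ∏ j ∈ Finset.range n, f (R j) ∂(Measure.infinitePi fun _ : ℕ => μ)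
      = (∫⁻ u, f u ∂μ) ^ n := by
  have hind := iIndepFun_infinitePi (P := fun _ : ℕ => μ) (X := fun _ : ℕ => f)
    (fun _ => hf)
  have := lintegral_prod_eq_prod_lintegral_of_indepFun (μ := Measure.infinitePi fun _ : ℕ => μ)
    (Finset.range n) (fun (i : ℕ) (ω : ℕ → X) => f (ω i)) hind (fun i => by fun_prop)
  have h2 : ∀ i : ℕ, ∫⁻ R, f (R i) ∂(Measure.infinitePi fun _ : ℕ => μ) = ∫⁻ u, f u ∂μ := by
    intro i
    rw [← lintegral_map hf (measurable_pi_apply i), Measure.infinitePi_map_eval]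
  simp_rw [h2] at this
  simpa using this

/-- The probability generating function of the Poisson law: `E m^N = exp (λ (m - 1))`. -/
lemma lintegral_pow_poissonMeasure (r : ℝ≥0) {m : ℝ} (hm : 0 ≤ m) :
    ∫⁻ n, ENNReal.ofReal m ^ n ∂(poissonMeasure r) = ENNReal.ofReal (Real.exp (r * m - r)) := by
  rw [poissonMeasure, lintegral_sum_measure]
  simp only [lintegral_smul_measure, lintegral_dirac, smul_eq_mul]
  have h : ∀ n : ℕ, ENNReal.ofReal (Real.exp (-r) * r ^ n / n.factorial) * ENNReal.ofReal m ^ n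
      = ENNReal.ofReal (Real.exp (-r) * ((r * m) ^ n / n.factorial)) := by
    intro n
    rw [← ENNReal.ofReal_pow hm, ← ENNReal.ofReal_mul (by positivity)]
    congr 1; rw [mul_pow]; ring
  simp_rw [h]
  rw [← ENNReal.ofReal_tsum_of_nonneg (fun n => by positivity)]
  · congr 1
    rw [tsum_mul_left, sub_eq_neg_add, Real.exp_add, Real.exp_eq_exp_ℝ,
      NormedSpace.exp_eq_tsum_div]
  · exact (Real.summable_pow_div_factorial _).mul_left _

end BarkerLangevin

namespace BarkerLangevin

section
variable {d : ℕ} {s : Euc d → Euc d} {C : Euc d → Euc d → ℝ}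

/-- The affine form of the line integrand for the score `s x = -x`. -/
lemma lineIntegrand_neg (hs : ∀ x, s x = -x) (x y : Euc d) (u : ℝ) :
    lineIntegrand s x y u = -inner ℝ x (y - x) - u * ‖y - x‖ ^ 2 := by
  rw [lineIntegrand, hs, inner_neg_left, inner_add_left, real_inner_smul_left,
    real_inner_self_eq_norm_sq]
  ring

lemma measurable_weight (hs : ∀ x, s x = -x) (x y : Euc d) :
    Measurable fun q : ℕ × (ℕ → ℝ) => weight s C x y q.1 q.2 := by
  refine measurable_from_prod_countable_right fun n => ?_
  simp only [weight, lineIntegrand_neg hs]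
  fun_prop

/-- Each factor of `W` is a probability. For `C x y = 0` the quotient is `0`, and the factor is
`1/2`. -/
lemma factor_mem_Icc (hC : IsScoreBound s C) (x y : Euc d) {u : ℝ} (hu : u ∈ Icc (0 : ℝ) 1) :
    1 / 2 + lineIntegrand s x y u / (2 * C x y) ∈ Icc (0 : ℝ) 1 := by
  have h := abs_le.1 (hC x y u hu)
  have hc : 0 ≤ C x y := (abs_nonneg _).trans (hC x y u hu)
  rcases hc.eq_or_lt with h0 | h0
  · rw [← h0]; norm_num
  · have e : 1 / 2 + lineIntegrand s x y u / (2 * C x y)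
        = (C x y + lineIntegrand s x y u) / (2 * C x y) := by field_simp
    rw [e]
    exact ⟨div_nonneg (by linarith) (by linarith), (div_le_one (by linarith)).2 (by linarith)⟩

lemma weight_mem (hC : IsScoreBound s C) (x y : Euc d) (n : ℕ) {R : ℕ → ℝ}
    (hR : ∀ j, R j ∈ Icc (0 : ℝ) 1) : weight s C x y n R ∈ Icc (0 : ℝ) 1 :=
  ⟨Finset.prod_nonneg fun j _ => (factor_mem_Icc hC x y (hR j)).1,
    Finset.prod_le_one (fun j _ => (factor_mem_Icc hC x y (hR j)).1)
      fun j _ => (factor_mem_Icc hC x y (hR j)).2⟩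

lemma ae_mem_infinitePi_unif :
    ∀ᵐ R ∂(Measure.infinitePi fun _ : ℕ => unif), ∀ j, R j ∈ Icc (0 : ℝ) 1 := by
  rw [ae_all_iff]
  intro j
  have h : ∀ᵐ u ∂unif, u ∈ Icc (0 : ℝ) 1 := by
    rw [unif]; exact ae_restrict_mem measurableSet_Icc
  have h2 : ∀ᵐ u ∂(Measure.infinitePi fun _ : ℕ => unif).map (fun R => R j),
      u ∈ Icc (0 : ℝ) 1 := by
    rw [Measure.infinitePi_map_eval]; exact h
  exact ae_of_ae_map (measurable_pi_apply j).aemeasurable h2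

/-- The mean `m` of a factor of `W` satisfies `2 C m = C + ∫ I`, where `I` is the line integrand and
`∫ I = log (p y / p x)`. This holds for `C = 0` as well, since then `I = 0`. -/
lemma lintegral_factor (hs : ∀ x, s x = -x) (hC : IsScoreBound s C) (x y : Euc d) :
    ∃ m : ℝ, 0 ≤ m ∧
      ∫⁻ u, ENNReal.ofReal (1 / 2 + lineIntegrand s x y u / (2 * C x y)) ∂unif = ENNReal.ofReal m ∧
      2 * C x y * m = C x y + (‖x‖ ^ 2 - ‖y‖ ^ 2) / 2 := by
  have hint : Integrable (fun u => 1 / 2 + lineIntegrand s x y u / (2 * C x y)) unif := by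
    rw [unif]
    refine ContinuousOn.integrableOn_compact isCompact_Icc ?_
    simp only [lineIntegrand_neg hs]
    fun_prop
  have hnn : 0 ≤ᵐ[unif] fun u => 1 / 2 + lineIntegrand s x y u / (2 * C x y) := by
    rw [unif]
    filter_upwards [ae_restrict_mem measurableSet_Icc] with u hu
    exact (factor_mem_Icc hC x y hu).1
  refine ⟨∫ u, 1 / 2 + lineIntegrand s x y u / (2 * C x y) ∂unif, integral_nonneg_of_ae hnn,
    (ofReal_integral_eq_lintegral_ofReal hint hnn).symm, ?_⟩
  have hI : ∫ u, lineIntegrand s x y u ∂unif = (‖x‖ ^ 2 - ‖y‖ ^ 2) / 2 := by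
    rw [unif, integral_Icc_eq_integral_Ioc,
      ← intervalIntegral.integral_of_le zero_le_one]
    simp only [lineIntegrand_neg hs]
    rw [intervalIntegral.integral_sub (by simp) (Continuous.intervalIntegrable (by fun_prop) _ _),
      intervalIntegral.integral_mul_const, integral_id, intervalIntegral.integral_const]
    rw [norm_sub_sq_real, inner_sub_right, real_inner_self_eq_norm_sq, real_inner_comm]
    simp only [smul_eq_mul]
    ring
  have hI' : Integrable (fun u => lineIntegrand s x y u) unif := by
    rw [unif]
    refine ContinuousOn.integrableOn_compact isCompact_Icc ?_
    simp only [lineIntegrand_neg hs]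
    fun_prop
  rw [integral_add (integrable_const _) (hI'.div_const _),
    integral_div (2 * C x y) (fun u => lineIntegrand s x y u), hI]
  simp only [integral_const, probReal_univ, smul_eq_mul, one_mul]
  by_cases h0 : C x y = 0
  · have hz : ∫ u, lineIntegrand s x y u ∂unif = 0 := by
      rw [← integral_zero ℝ ℝ (μ := unif)]
      apply integral_congr_ae
      rw [unif]
      filter_upwards [ae_restrict_mem measurableSet_Icc] with u hu
      exact abs_nonpos_iff.1 ((hC x y u hu).trans_eq h0)
    rw [h0, ← hI, hz]; simp
  · field_simp

/-- The acceptance coin of a round shows heads with probability `e^{-C} p(y) / p(x)`: the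
mean of `W` over the points is `m ^ N`, and `E m^N = e^{2 C m - 2 C}`. -/
lemma prob_coin (hs : ∀ x, s x = -x) (hC : IsScoreBound s C) (x y : Euc d) :
    ((poissonMeasure (2 * C x y).toNNReal).prod
      ((Measure.infinitePi fun _ : ℕ => unif).prod unif))
      {q | q.2.2 ≤ weight s C x y q.1 q.2.1}
      = ENNReal.ofReal (Real.exp (-C x y + (‖x‖ ^ 2 - ‖y‖ ^ 2) / 2)) := by
  have hc : 0 ≤ C x y := (abs_nonneg _).trans (hC x y 0 (by simp))
  have hm := measurable_weight (C := C) hs x y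
  have hT : MeasurableSet {q : ℕ × (ℕ → ℝ) × ℝ | q.2.2 ≤ weight s C x y q.1 q.2.1} :=
    measurableSet_le (by fun_prop) (hm.comp (g := fun q : ℕ × (ℕ → ℝ) => weight s C x y q.1 q.2)
      (f := fun q : ℕ × (ℕ → ℝ) × ℝ => (q.1, q.2.1)) (by fun_prop))
  obtain ⟨m, hm0, hm1, hm2⟩ := lintegral_factor hs hC x y
  have hf : Measurable fun u => ENNReal.ofReal (1 / 2 + lineIntegrand s x y u / (2 * C x y)) := by
    simp only [lineIntegrand_neg hs]; fun_prop
  rw [Measure.prod_apply hT]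
  have h1 : ∀ n : ℕ, ((Measure.infinitePi fun _ : ℕ => unif).prod unif)
      (Prod.mk n ⁻¹' {q : ℕ × (ℕ → ℝ) × ℝ | q.2.2 ≤ weight s C x y q.1 q.2.1})
      = ENNReal.ofReal m ^ n := by
    intro n
    rw [Measure.prod_apply (measurable_prodMk_left hT), ← hm1,
      ← lintegral_infinitePi_prod_range unif hf n]
    refine lintegral_congr_ae ?_
    filter_upwards [ae_mem_infinitePi_unif] with R hR
    have : Prod.mk R ⁻¹' (Prod.mk n ⁻¹' {q : ℕ × (ℕ → ℝ) × ℝ | q.2.2 ≤ weight s C x y q.1 q.2.1})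
        = Iic (weight s C x y n R) := rfl
    rw [this, unif_Iic (weight_mem hC x y n hR), weight, ENNReal.ofReal_prod_of_nonneg]
    exact fun j _ => (factor_mem_Icc hC x y (hR j)).1
  simp_rw [h1]
  rw [lintegral_pow_poissonMeasure _ hm0, Real.coe_toNNReal _ (by linarith), hm2]
  congr 2; ring

/-- With `H = p(x) / p(y) · e^R`, the algorithm accepts with Barker's probability `σ(R)`. -/
lemma coinLaw_accepts (hs : ∀ x, s x = -x) (hC : IsScoreBound s C) (h : ℝ) (x y : Euc d) (R : ℝ)
    (hR : proposalRatio s h x y = Real.exp (R - (‖x‖ ^ 2 - ‖y‖ ^ 2) / 2)) :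
    MeasurableSet {ω | Accepts s C h x y ω} ∧
    coinLaw (C x y) {ω | Accepts s C h x y ω} = ENNReal.ofReal (Real.sigmoid R) := by
  have hc : 0 ≤ C x y := (abs_nonneg _).trans (hC x y 0 (by simp))
  set α := rejectProb s C h x y with hα
  set D := (‖x‖ ^ 2 - ‖y‖ ^ 2) / 2 with hD
  have hα' : α = (1 + Real.exp (R - D + C x y))⁻¹ := by
    rw [hα, rejectProb, hR, ← Real.exp_add]
  have hα01 : α ∈ Icc (0 : ℝ) 1 := by
    rw [hα']
    exact ⟨by positivity, inv_le_one_of_one_le₀ (by linarith [Real.exp_pos (R - D + C x y)])⟩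
  have hm := measurable_weight (C := C) hs x y
  set T : Set (ℕ × (ℕ → ℝ) × ℝ) := {q | q.2.2 ≤ weight s C x y q.1 q.2.1} with hTdef
  have hT : MeasurableSet T :=
    measurableSet_le (by fun_prop) (hm.comp (g := fun q : ℕ × (ℕ → ℝ) => weight s C x y q.1 q.2)
      (f := fun q : ℕ × (ℕ → ℝ) × ℝ => (q.1, q.2.1)) (by fun_prop))
  set B : Set Round := {r | RoundRejects s C h x y r} with hB
  set A : Set Round := {r | RoundAccepts s C h x y r} with hA
  have hBe : B = Iic α ×ˢ univ := by
    ext r; simp [hB, RoundRejects, hα]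
  have hAe : A = (Iic α)ᶜ ×ˢ T := by
    ext r; simp [hA, RoundAccepts, RoundRejects, hα, hTdef]
  have hBm : MeasurableSet B := hBe ▸ measurableSet_Iic.prod .univ
  have hAm : MeasurableSet A := hAe ▸ measurableSet_Iic.compl.prod hT
  have hdis : Disjoint A B := by
    rw [Set.disjoint_left]; intro r h1 h2; exact h1.1 h2
  have key := infinitePi_first_mem (roundLaw (C x y)) hAm hBm hdis
  refine ⟨key.1, ?_⟩
  refine key.2.trans ?_
  have hPB : roundLaw (C x y) B = ENNReal.ofReal α := by
    rw [hBe, roundLaw, Measure.prod_prod, unif_Iic hα01]; simp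
  have hPA : roundLaw (C x y) A = ENNReal.ofReal ((1 - α) * Real.exp (-C x y + D)) := by
    rw [hAe, roundLaw, Measure.prod_prod, prob_coin hs hC, prob_compl_eq_one_sub measurableSet_Iic,
      unif_Iic hα01, ENNReal.ofReal_mul (by linarith [hα01.2]), ENNReal.ofReal_sub _ hα01.1,
      ENNReal.ofReal_one]
  have hαpos : 0 < α := by rw [hα']; positivity
  have h1α : 0 ≤ 1 - α := by linarith [hα01.2]
  rw [hPA, hPB, ← ENNReal.ofReal_add (by positivity) hα01.1,
    ← ENNReal.ofReal_div_of_pos (by positivity)]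
  congr 1
  rw [Real.sigmoid_def, hα']
  set P := Real.exp (R - D + C x y) with hP
  have e1 : Real.exp (-R) = (P * Real.exp (-C x y + D))⁻¹ := by
    rw [hP, ← Real.exp_add, ← Real.exp_neg]; congr 1; ring
  have hPpos : 0 < P := Real.exp_pos _
  have hE : 0 < Real.exp (-C x y + D) := Real.exp_pos _
  rw [e1]
  generalize Real.exp (-C x y + D) = Q at hE
  have : 1 - (1 + P)⁻¹ = P / (1 + P) := by field_simp; ring
  have h3 : 1 + (P * Q)⁻¹ = (P * Q + 1) / (P * Q) := by field_simp
  rw [this, h3]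
  field_simp

end
end BarkerLangevin

namespace BarkerLangevin

/-! ### The stationary law and the acceptance probability -/

variable {d : ℕ}

lemma stdDensity_eq (x : Euc d) :
    stdDensity d x = (2 * Real.pi) ^ (-(d : ℝ) / 2) * Real.exp (-(1 / 2) * ‖x‖ ^ 2) := by
  rw [stdDensity, gaussianDensity]; simp only [sub_zero, mul_one]; congr 2; ring

lemma IsExactScore.eq_neg {s : Euc d → Euc d} (hs : IsExactScore (stdDensity d) s) (x : Euc d) :
    s x = -x := by
  rw [hs x]
  have h : (fun y : Euc d => Real.log (stdDensity d y))
      = fun y => Real.log ((2 * Real.pi) ^ (-(d : ℝ) / 2)) + (-(1 / 2)) * ‖y‖ ^ 2 := by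
    ext y
    rw [stdDensity_eq, Real.log_mul (by positivity) (Real.exp_ne_zero _), Real.log_exp]
  rw [h]
  refine HasGradientAt.gradient ?_
  rw [hasGradientAt_iff_hasFDerivAt]
  have h1 := ((hasStrictFDerivAt_norm_sq x).hasFDerivAt.const_mul (-(1 / 2) : ℝ)).const_add
    (Real.log ((2 * Real.pi) ^ (-(d : ℝ) / 2)))
  refine h1.congr_fderiv ?_
  ext y
  simp [innerSL_apply_apply]

lemma integrable_stdDensity : Integrable (stdDensity d) := by
  have h := (GaussianFourier.integrable_cexp_neg_mul_sq_norm_add (V := Euc d) (b := (1 / 2 : ℝ))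
    (by norm_num) 0 0).norm
  have h2 : Integrable (fun v : Euc d => Real.exp (-(1 / 2) * ‖v‖ ^ 2)) := by
    refine h.congr (ae_of_all _ fun v => ?_)
    simp only [Complex.norm_exp]
    congr 1
    simp only [inner_zero_left, Complex.ofReal_zero, mul_zero, add_zero, ← Complex.ofReal_neg,
      ← Complex.ofReal_pow, ← Complex.ofReal_mul, Complex.ofReal_re]
  have := h2.const_mul ((2 * Real.pi) ^ (-(d : ℝ) / 2))
  exact this.congr (ae_of_all _ fun v => (stdDensity_eq v).symm)

lemma stdDensity_nonneg (x : Euc d) : 0 ≤ stdDensity d x := by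
  rw [stdDensity_eq]; positivity

instance : IsFiniteMeasure (lawOfDensity (stdDensity d)) :=
  isFiniteMeasure_withDensity_ofReal integrable_stdDensity.2

lemma measurable_stdDensity : Measurable (stdDensity d) := by
  rw [show stdDensity d = _ from funext stdDensity_eq]; fun_prop

lemma integral_lawOfDensity {E : Type*} [NormedAddCommGroup E] [NormedSpace ℝ E] (f : Euc d → E) :
    ∫ x, f x ∂(lawOfDensity (stdDensity d)) = ∫ x, stdDensity d x • f x := by
  rw [lawOfDensity, integral_withDensity_eq_integral_toReal_smul
    measurable_stdDensity.ennreal_ofReal (ae_of_all _ fun _ => ENNReal.ofReal_lt_top)]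
  simp_rw [ENNReal.toReal_ofReal (stdDensity_nonneg _)]

lemma lawOfDensity_stdDensity : lawOfDensity (stdDensity d) = stdGaussian (Euc d) := by
  apply Measure.ext_of_charFun
  ext t
  rw [charFun_stdGaussian, charFun_apply, integral_lawOfDensity]
  have h := GaussianFourier.integral_cexp_neg_mul_sq_norm_add (V := Euc d) (b := (1 / 2 : ℝ))
    (by norm_num) Complex.I t
  have h2 : ∀ v : Euc d, stdDensity d v • Complex.exp (inner ℝ v t * Complex.I)
      = (((2 * Real.pi) ^ (-(d : ℝ) / 2) : ℝ) : ℂ) *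
        Complex.exp (-((1 / 2 : ℝ) : ℂ) * ‖v‖ ^ 2 + Complex.I * inner ℝ t v) := by
    intro v
    rw [stdDensity_eq, Complex.real_smul, Complex.ofReal_mul, mul_assoc, Complex.ofReal_exp,
      ← Complex.exp_add, real_inner_comm v t]
    congr 2
    push_cast; ring
  simp_rw [h2]
  rw [integral_const_mul, h, ← mul_assoc]
  have h3 : (((2 * Real.pi) ^ (-(d : ℝ) / 2) : ℝ) : ℂ) *
      (Real.pi / ((1 / 2 : ℝ) : ℂ)) ^ (Module.finrank ℝ (Euc d) / 2 : ℂ) = 1 := by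
    have e : (Real.pi / ((1 / 2 : ℝ) : ℂ)) ^ (Module.finrank ℝ (Euc d) / 2 : ℂ)
        = (((2 * Real.pi) ^ ((d : ℝ) / 2) : ℝ) : ℂ) := by
      rw [Complex.ofReal_cpow (by positivity)]
      congr 1
      · push_cast; ring
      · simp
    rw [e, ← Complex.ofReal_mul, ← Real.rpow_add (by positivity)]
    norm_num [neg_div]
  rw [h3, one_mul]
  congr 1
  rw [Complex.I_sq]; push_cast; ring

/-- The proposal from `x` with Gaussian noise `z`, for the score `s x = -x`. -/
noncomputable def prop (h : ℝ) (x z : Euc d) : Euc d := (1 - h / 2) • x + Real.sqrt h • z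

/-- The logarithm of Barker's ratio `p(y) q(x | y) / (p(x) q(y | x))`. -/
noncomputable def logRatio (h : ℝ) (x z : Euc d) : ℝ := h / 8 * (‖x‖ ^ 2 - ‖prop h x z‖ ^ 2)

lemma proposal_eq {s : Euc d → Euc d} (hs : ∀ x, s x = -x) (h : ℝ) (x z : Euc d) :
    proposal s h x z = prop h x z := by
  rw [proposal, prop, hs]; module

lemma proposalRatio_eq {s : Euc d → Euc d} (hs : ∀ x, s x = -x) {h : ℝ} (hh : 0 < h)
    (x y : Euc d) :
    proposalRatio s h x y
      = Real.exp (h / 8 * (‖x‖ ^ 2 - ‖y‖ ^ 2) - (‖x‖ ^ 2 - ‖y‖ ^ 2) / 2) := by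
  rw [proposalRatio, proposalDensity, proposalDensity, gaussianDensity, gaussianDensity, hs, hs,
    mul_div_mul_left _ _ (by positivity), ← Real.exp_sub]
  congr 1
  have e1 : x - (y + (h / 2) • -y) = x - (1 - h / 2) • y := by module
  have e2 : y - (x + (h / 2) • -x) = y - (1 - h / 2) • x := by module
  rw [e1, e2, norm_sub_sq_real, norm_sub_sq_real, inner_smul_right, inner_smul_right,
    norm_smul, norm_smul, real_inner_comm, mul_pow, mul_pow, Real.norm_eq_abs, sq_abs]
  field_simp
  ring

/-- The mean over the state `x` and the noise `z` of the stationary chain. -/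
noncomputable abbrev gaussPair (d : ℕ) : Measure (Euc d × Euc d) :=
  (stdGaussian (Euc d)).prod (stdGaussian (Euc d))

lemma continuous_prop (h : ℝ) : Continuous fun q : Euc d × Euc d => prop h q.1 q.2 := by
  unfold prop; fun_prop

lemma continuous_logRatio (h : ℝ) : Continuous fun q : Euc d × Euc d => logRatio h q.1 q.2 := by
  unfold logRatio; have := continuous_prop (d := d) h; fun_prop

/-- `‖y - x‖² σ(R)`: the squared jump times Barker's acceptance probability. -/
noncomputable def jumpIntegrand (h : ℝ) (q : Euc d × Euc d) : ℝ :=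
  ‖prop h q.1 q.2 - q.1‖ ^ 2 * Real.sigmoid (logRatio h q.1 q.2)

lemma continuous_jumpIntegrand (h : ℝ) : Continuous (jumpIntegrand (d := d) h) := by
  unfold jumpIntegrand
  have := continuous_prop (d := d) h
  have h2 := continuous_sigmoid.comp (continuous_logRatio (d := d) h)
  simp only [Function.comp_def] at h2
  fun_prop

lemma jumpIntegrand_nonneg (h : ℝ) (q : Euc d × Euc d) : 0 ≤ jumpIntegrand h q :=
  mul_nonneg (by positivity) (Real.sigmoid_nonneg _)

section
variable {s : Euc d → Euc d} {C : Euc d → Euc d → ℝ}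

lemma coinLaw_accepts_prop (hs : ∀ x, s x = -x) (hC : IsScoreBound s C) {h : ℝ} (hh : 0 < h)
    (x z : Euc d) :
    MeasurableSet {ω | Accepts s C h x (prop h x z) ω} ∧
    coinLaw (C x (prop h x z)) {ω | Accepts s C h x (prop h x z) ω}
      = ENNReal.ofReal (Real.sigmoid (logRatio h x z)) :=
  coinLaw_accepts hs hC h x _ _ (proposalRatio_eq hs hh x _)

theorem esjd_eq (hs : ∀ x, s x = -x) (hC : IsScoreBound s C) {h : ℝ} (hh : 0 < h) :
    esjd (stdDensity d) s C h = ∫⁻ q, ENNReal.ofReal (jumpIntegrand h q) ∂(gaussPair d) := by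
  rw [esjd, lawOfDensity_stdDensity, lintegral_prod _
    (continuous_jumpIntegrand h).measurable.ennreal_ofReal.aemeasurable]
  refine lintegral_congr fun x => lintegral_congr fun z => ?_
  rw [proposal_eq hs]
  obtain ⟨hm, hP⟩ := coinLaw_accepts_prop hs hC hh x z
  have e : ∀ ω, ENNReal.ofReal (‖nextState s C h x (prop h x z) ω - x‖ ^ 2)
      = {ω | Accepts s C h x (prop h x z) ω}.indicator
        (fun _ => ENNReal.ofReal (‖prop h x z - x‖ ^ 2)) ω := by
    intro ω
    by_cases ha : Accepts s C h x (prop h x z) ω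
    · simp [nextState, ha]
    · simp [nextState, ha]
  simp_rw [e]
  rw [lintegral_indicator_const hm, hP, jumpIntegrand, ENNReal.ofReal_mul (by positivity)]

theorem acceptanceRate_eq (hs : ∀ x, s x = -x) (hC : IsScoreBound s C) {h : ℝ} (hh : 0 < h) :
    acceptanceRate (stdDensity d) s C h
      = ∫ q, Real.sigmoid (logRatio h q.1 q.2) ∂(gaussPair d) := by
  have hc := continuous_sigmoid.comp (continuous_logRatio (d := d) h)
  simp only [Function.comp_def] at hc
  rw [acceptanceRate, lawOfDensity_stdDensity, integral_eq_lintegral_of_nonneg_ae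
    (ae_of_all _ fun _ => Real.sigmoid_nonneg _) hc.aestronglyMeasurable, lintegral_prod _
    hc.measurable.ennreal_ofReal.aemeasurable]
  congr 1
  refine lintegral_congr fun x => lintegral_congr fun z => ?_
  rw [proposal_eq hs]
  exact (coinLaw_accepts_prop hs hC hh x z).2

end
end BarkerLangevin

namespace BarkerLangevin

variable {d : ℕ}

/-! ### Gaussian exponentials of quadratic forms and the tail of the jump distance -/

lemma lintegral_stdGaussian {f : Euc d → ℝ} (hf : Measurable f) :
    ∫⁻ x, ENNReal.ofReal (f x) ∂(stdGaussian (Euc d))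
      = ∫⁻ x, ENNReal.ofReal (stdDensity d x * f x) := by
  rw [← lawOfDensity_stdDensity, lawOfDensity, lintegral_withDensity_eq_lintegral_mul _
    measurable_stdDensity.ennreal_ofReal hf.ennreal_ofReal]
  refine lintegral_congr fun x => ?_
  rw [ENNReal.ofReal_mul (stdDensity_nonneg x)]; rfl

lemma lintegral_exp_neg_mul_sq_norm_add {b : ℝ} (hb : 0 < b) (w : Euc d) :
    ∫⁻ v : Euc d, ENNReal.ofReal (Real.exp (-b * ‖v‖ ^ 2 + inner ℝ w v))
      = ENNReal.ofReal ((Real.pi / b) ^ ((d : ℝ) / 2) * Real.exp (‖w‖ ^ 2 / (4 * b))) := by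
  have h1 : ∀ v : Euc d, Real.exp (-b * ‖v‖ ^ 2 + inner ℝ w v)
      = Real.exp (‖w‖ ^ 2 / (4 * b)) * Real.exp (-b * ‖v - (1 / (2 * b)) • w‖ ^ 2) := by
    intro v
    rw [← Real.exp_add, norm_sub_sq_real, inner_smul_right, norm_smul, mul_pow, Real.norm_eq_abs,
      sq_abs, real_inner_comm]
    congr 1; field_simp; ring
  have hint : Integrable (fun v : Euc d => Real.exp (-b * ‖v‖ ^ 2)) := by
    have h := (GaussianFourier.integrable_cexp_neg_mul_sq_norm_add (V := Euc d) (b := (b : ℂ))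
      (by simpa using hb) 0 0).norm
    refine h.congr (ae_of_all _ fun v => ?_)
    simp only [Complex.norm_exp]
    congr 1
    simp only [inner_zero_left, Complex.ofReal_zero, mul_zero, add_zero, ← Complex.ofReal_neg,
      ← Complex.ofReal_pow, ← Complex.ofReal_mul, Complex.ofReal_re]
  simp_rw [h1]
  rw [← ofReal_integral_eq_lintegral_ofReal ((hint.comp_sub_right _).const_mul _)
    (ae_of_all _ fun _ => by positivity), integral_const_mul,
    integral_sub_right_eq_self (fun v : Euc d => Real.exp (-b * ‖v‖ ^ 2)),
    GaussianFourier.integral_rexp_neg_mul_sq_norm hb]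
  simp [mul_comm]

lemma lintegral_stdGaussian_exp {c : ℝ} (hc : c < 1) (w : Euc d) :
    ∫⁻ z, ENNReal.ofReal (Real.exp (inner ℝ w z + c / 2 * ‖z‖ ^ 2)) ∂(stdGaussian (Euc d))
      = ENNReal.ofReal ((√((1 - c) ^ d))⁻¹ * Real.exp (‖w‖ ^ 2 / (2 * (1 - c)))) := by
  have hc' : 0 < 1 - c := by linarith
  rw [lintegral_stdGaussian (by fun_prop)]
  have h1 : ∀ z : Euc d, stdDensity d z * Real.exp (inner ℝ w z + c / 2 * ‖z‖ ^ 2)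
      = (2 * Real.pi) ^ (-(d : ℝ) / 2) *
        Real.exp (-((1 - c) / 2) * ‖z‖ ^ 2 + inner ℝ w z) := by
    intro z
    rw [stdDensity_eq, mul_assoc, ← Real.exp_add]; congr 2; ring
  simp_rw [h1, ENNReal.ofReal_mul (by positivity : 0 ≤ (2 * Real.pi) ^ (-(d : ℝ) / 2))]
  rw [lintegral_const_mul _ (by fun_prop), lintegral_exp_neg_mul_sq_norm_add (by linarith),
    ← ENNReal.ofReal_mul (by positivity), ← mul_assoc]
  congr 2
  · have e1 : Real.pi / ((1 - c) / 2) = 2 * Real.pi * (1 - c)⁻¹ := by field_simp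
    rw [e1, Real.mul_rpow (x := 2 * Real.pi) (by positivity) (by positivity), ← mul_assoc,
      ← Real.rpow_add (by positivity), neg_div, neg_add_cancel, Real.rpow_zero, one_mul,
      Real.inv_rpow hc'.le, Real.sqrt_eq_rpow, ← Real.rpow_natCast, ← Real.rpow_mul hc'.le]
    congr 2; ring
  · congr 1; field_simp; ring

/-- The Gaussian integral of the exponential of a quadratic form in `(x, z)`. -/
lemma lintegral_gaussPair_exp {a b c : ℝ} (hc : c < 1) (hD : 0 < (1 - a) * (1 - c) - b ^ 2) :
    ∫⁻ q, ENNReal.ofReal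
        (Real.exp (a / 2 * ‖q.1‖ ^ 2 + b * inner ℝ q.1 q.2 + c / 2 * ‖q.2‖ ^ 2)) ∂(gaussPair d)
      = ENNReal.ofReal (√(((1 - a) * (1 - c) - b ^ 2) ^ d))⁻¹ := by
  have hc' : 0 < 1 - c := by linarith
  rw [lintegral_prod _ (by fun_prop)]
  have h1 : ∀ x : Euc d, ∫⁻ z, ENNReal.ofReal
        (Real.exp (a / 2 * ‖x‖ ^ 2 + b * inner ℝ x z + c / 2 * ‖z‖ ^ 2)) ∂(stdGaussian (Euc d))
      = ENNReal.ofReal (√((1 - c) ^ d))⁻¹ * ENNReal.ofReal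
        (Real.exp (inner ℝ (0 : Euc d) x + (a + b ^ 2 / (1 - c)) / 2 * ‖x‖ ^ 2)) := by
    intro x
    have : ∀ z : Euc d, Real.exp (a / 2 * ‖x‖ ^ 2 + b * inner ℝ x z + c / 2 * ‖z‖ ^ 2)
        = Real.exp (a / 2 * ‖x‖ ^ 2) * Real.exp (inner ℝ (b • x) z + c / 2 * ‖z‖ ^ 2) := by
      intro z
      rw [← Real.exp_add, real_inner_smul_left]; congr 1; ring
    simp_rw [this, ENNReal.ofReal_mul (Real.exp_nonneg _)]
    rw [lintegral_const_mul _ (by fun_prop), lintegral_stdGaussian_exp hc,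
      ← ENNReal.ofReal_mul (by positivity), ← ENNReal.ofReal_mul (by positivity),
      mul_left_comm, ← Real.exp_add, norm_smul, mul_pow, Real.norm_eq_abs, sq_abs, inner_zero_left]
    congr 3; field_simp; ring
  simp only at h1
  simp_rw [h1]
  have h2 : 1 - (a + b ^ 2 / (1 - c)) = ((1 - a) * (1 - c) - b ^ 2) / (1 - c) := by
    field_simp; ring
  have h3 : 0 < 1 - (a + b ^ 2 / (1 - c)) := by rw [h2]; positivity
  rw [lintegral_const_mul _ (by fun_prop), lintegral_stdGaussian_exp (by linarith),
    ← ENNReal.ofReal_mul (by positivity), norm_zero, h2, ← mul_assoc, ← mul_inv,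
    ← Real.sqrt_mul (by positivity), ← mul_pow, mul_div_cancel₀ _ hc'.ne']
  simp

lemma norm_sq_prop (h : ℝ) (hh : 0 ≤ h) (x z : Euc d) :
    ‖prop h x z‖ ^ 2 = (1 - h / 2) ^ 2 * ‖x‖ ^ 2 + 2 * (1 - h / 2) * √h * inner ℝ x z
      + h * ‖z‖ ^ 2 := by
  rw [prop, norm_add_sq_real, inner_smul_left, inner_smul_right, norm_smul, norm_smul, mul_pow,
    mul_pow, Real.norm_eq_abs, Real.norm_eq_abs, sq_abs, sq_abs, Real.sq_sqrt hh]
  simp only [conj_trivial]; ring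

lemma norm_sq_prop_sub (h : ℝ) (hh : 0 ≤ h) (x z : Euc d) :
    ‖prop h x z - x‖ ^ 2 = h ^ 2 / 4 * ‖x‖ ^ 2 - h * √h * inner ℝ x z + h * ‖z‖ ^ 2 := by
  have e : prop h x z - x = (-(h / 2)) • x + √h • z := by rw [prop]; module
  rw [e, norm_add_sq_real, inner_smul_left, inner_smul_right, norm_smul, norm_smul, mul_pow,
    mul_pow, Real.norm_eq_abs, Real.norm_eq_abs, sq_abs, sq_abs, Real.sq_sqrt hh]
  simp only [conj_trivial]; ring

lemma logRatio_eq (h : ℝ) (hh : 0 ≤ h) (x z : Euc d) :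
    logRatio h x z = h / 8 * ((h - h ^ 2 / 4) * ‖x‖ ^ 2 - 2 * (1 - h / 2) * √h * inner ℝ x z
      - h * ‖z‖ ^ 2) := by
  rw [logRatio, norm_sq_prop h hh]; ring

lemma sigmoid_le_exp_half (t : ℝ) : Real.sigmoid t ≤ Real.exp (t / 2) / 2 := by
  rw [Real.sigmoid_def]
  have e : Real.exp (-t) = (Real.exp (t / 2))⁻¹ ^ 2 := by
    rw [← Real.exp_neg, ← Real.exp_nat_mul]; congr 1; push_cast; ring
  rw [e]
  have hp := Real.exp_pos (t / 2)
  generalize Real.exp (t / 2) = p at hp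
  rw [inv_le_comm₀ (by positivity) (by positivity), inv_div]
  have : 0 ≤ (1 - p⁻¹) ^ 2 := sq_nonneg _
  have e2 : 2 / p = 2 * p⁻¹ := by ring
  rw [e2]; nlinarith

/-- The expected squared jump is at most of order `h d (1 + d h³ / 64)^{-1/2}`, uniformly in `h` and
`d`. The reason is `σ(R) ≤ e^{R/2} / 2`, and that `e^{R/2}` turns the joint density of `(x, y)` into
the geometric mean of it and its reflection, a Gaussian integral. -/
theorem lintegral_jumpIntegrand_le (hd : 1 ≤ d) {h : ℝ} (hh : 0 < h) :
    ∫⁻ q, ENNReal.ofReal (jumpIntegrand h q) ∂(gaussPair d)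
      ≤ ENNReal.ofReal (8 * h * d / √(1 + d * h ^ 3 / 64)) := by
  have hd0 : (1 : ℝ) ≤ d := by exact_mod_cast hd
  have hd1 : (0 : ℝ) < d := by linarith
  -- `‖y - x‖²` is bounded by `e^{ε ‖y - x‖²} / ε`. This `ε` changes the determinant only by a
  -- factor `1 - O(1 / d)`, which the `d`-th power turns into a constant.
  set ε : ℝ := 1 / (8 * h * d) with hε
  have hεpos : 0 < ε := by positivity
  have hεh : ε * h = 1 / (8 * d) := by rw [hε]; field_simp
  set a : ℝ := ε * h ^ 2 / 2 + h ^ 2 / 8 - h ^ 3 / 32 with ha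
  set b : ℝ := -(h * √h) * (ε + (1 - h / 2) / 8) with hb
  set c : ℝ := 2 * (ε * h) - h ^ 2 / 8 with hc
  have hsq : √h ^ 2 = h := Real.sq_sqrt hh.le
  have hdet : (1 - a) * (1 - c) - b ^ 2
      = 1 + h ^ 3 / 64 - 4 * (ε * h) * (1 / 2 + h / 8) := by
    have : b ^ 2 = h ^ 3 * (ε + (1 - h / 2) / 8) ^ 2 := by
      rw [hb, mul_pow, neg_sq, mul_pow, hsq]; ring
    rw [this, ha, hc]; ring
  have hcube : 1 / 2 + h / 8 ≤ 1 + h ^ 3 / 64 := by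
    nlinarith [mul_nonneg hh.le (sq_nonneg (h - 2)), sq_nonneg (h - 2), sq_nonneg (h-1)]
  have hinv : 1 / (2 * (d : ℝ)) ≤ 1 / 2 := by
    rw [div_le_div_iff₀ (by positivity) (by norm_num)]; linarith
  have hDlow : (1 - 1 / (2 * d)) * (1 + h ^ 3 / 64) ≤ (1 - a) * (1 - c) - b ^ 2 := by
    rw [hdet, hεh]
    have e : 4 * (1 / (8 * (d : ℝ))) = 1 / (2 * d) := by field_simp; norm_num
    rw [e]
    have : 0 < 1 / (2 * (d : ℝ)) := by positivity
    nlinarith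
  have hc1 : c < 1 := by
    have e : 2 * (ε * h) = 1 / (2 * d) / 2 := by rw [hεh]; field_simp; norm_num
    rw [hc, e]; nlinarith [sq_nonneg h]
  have hDpos : 0 < (1 - a) * (1 - c) - b ^ 2 :=
    lt_of_lt_of_le (mul_pos (by linarith) (by positivity)) hDlow
  have hpow : (1 + d * h ^ 3 / 64) / 4 ≤ ((1 - a) * (1 - c) - b ^ 2) ^ d := by
    calc (1 + d * h ^ 3 / 64) / 4 ≤ (1 / 2) * (1 + d * (h ^ 3 / 64)) := by
          have : 0 ≤ d * h ^ 3 := by positivity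
          linarith
      _ ≤ (1 - 1 / (2 * d)) ^ d * (1 + h ^ 3 / 64) ^ d := by
          have b1 := one_add_mul_le_pow (a := -(1 / (2 * (d : ℝ)))) (by linarith) d
          have b2 := one_add_mul_le_pow (a := h ^ 3 / 64)
            (by have : 0 < h ^ 3 := by positivity
                linarith) d
          have e : 1 + (d : ℝ) * -(1 / (2 * d)) = 1 / 2 := by field_simp; norm_num
          rw [e, ← sub_eq_add_neg] at b1
          exact mul_le_mul b1 b2 (by positivity) (le_trans (by norm_num) b1)
      _ = ((1 - 1 / (2 * d)) * (1 + h ^ 3 / 64)) ^ d := (mul_pow _ _ _).symm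
      _ ≤ _ := pow_le_pow_left₀ (mul_nonneg (by linarith) (by positivity)) hDlow d
  have hpt : ∀ q : Euc d × Euc d, jumpIntegrand h q ≤ (1 / (2 * ε)) *
      Real.exp (a / 2 * ‖q.1‖ ^ 2 + b * inner ℝ q.1 q.2 + c / 2 * ‖q.2‖ ^ 2) := by
    intro q
    have e1 : a / 2 * ‖q.1‖ ^ 2 + b * inner ℝ q.1 q.2 + c / 2 * ‖q.2‖ ^ 2
        = ε * ‖prop h q.1 q.2 - q.1‖ ^ 2 + logRatio h q.1 q.2 / 2 := by
      rw [norm_sq_prop_sub h hh.le, logRatio_eq h hh.le, ha, hb, hc]; ring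
    rw [e1, Real.exp_add, jumpIntegrand]
    have h1 : ε * ‖prop h q.1 q.2 - q.1‖ ^ 2 ≤ Real.exp (ε * ‖prop h q.1 q.2 - q.1‖ ^ 2) := by
      linarith [Real.add_one_le_exp (ε * ‖prop h q.1 q.2 - q.1‖ ^ 2)]
    have h2 := sigmoid_le_exp_half (logRatio h q.1 q.2)
    calc _ = (1 / ε) * ((ε * ‖prop h q.1 q.2 - q.1‖ ^ 2) * Real.sigmoid (logRatio h q.1 q.2)) := by
          field_simp
      _ ≤ (1 / ε) * (Real.exp (ε * ‖prop h q.1 q.2 - q.1‖ ^ 2) *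
          (Real.exp (logRatio h q.1 q.2 / 2) / 2)) := by
          gcongr
          exact Real.sigmoid_nonneg _
      _ = _ := by field_simp
  calc ∫⁻ q, ENNReal.ofReal (jumpIntegrand h q) ∂(gaussPair d)
      ≤ ∫⁻ q, ENNReal.ofReal (1 / (2 * ε)) * ENNReal.ofReal (Real.exp
          (a / 2 * ‖q.1‖ ^ 2 + b * inner ℝ q.1 q.2 + c / 2 * ‖q.2‖ ^ 2)) ∂(gaussPair d) := by
        refine lintegral_mono fun q => ?_
        rw [← ENNReal.ofReal_mul (by positivity)]
        exact ENNReal.ofReal_le_ofReal (hpt q)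
    _ = ENNReal.ofReal (1 / (2 * ε) * (√(((1 - a) * (1 - c) - b ^ 2) ^ d))⁻¹) := by
        rw [lintegral_const_mul _ (by fun_prop), lintegral_gaussPair_exp hc1 hDpos,
          ENNReal.ofReal_mul (by positivity)]
    _ ≤ _ := by
        refine ENNReal.ofReal_le_ofReal ?_
        have h4 : √(1 + d * h ^ 3 / 64) / 2 ≤ √(((1 - a) * (1 - c) - b ^ 2) ^ d) := by
          have : √(1 + d * h ^ 3 / 64) / 2 = √((1 + d * h ^ 3 / 64) / 4) := by
            rw [Real.sqrt_div (by positivity)]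
            congr 1
            rw [show (4 : ℝ) = 2 ^ 2 by norm_num, Real.sqrt_sq (by norm_num)]
          rw [this]; exact Real.sqrt_le_sqrt hpow
        have h5 : 0 < √(1 + d * h ^ 3 / 64) := Real.sqrt_pos.2 (by positivity)
        calc _ ≤ 1 / (2 * ε) * (√(1 + d * h ^ 3 / 64) / 2)⁻¹ := by gcongr
          _ = _ := by rw [hε]; field_simp

end BarkerLangevin

namespace BarkerLangevin

variable {d : ℕ}

/-! ### The acceptance function of the diffusion limit -/

/-- The standard Gaussian law on `ℝ`. -/
noncomputable abbrev gauss : Measure ℝ := gaussianReal 0 1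

/-- `K β = E (1 / cosh (β N))` for a standard Gaussian `N`. -/
noncomputable def sechMean (β : ℝ) : ℝ := ∫ n, (Real.cosh (β * n))⁻¹ ∂gauss

/-- The limiting acceptance rate `G β = e^{-β²/2} K(β) / 2`, where `β² = h³ d / 64`. -/
noncomputable def limitRate (β : ℝ) : ℝ := Real.exp (-β ^ 2 / 2) / 2 * sechMean β

lemma integral_gauss (f : ℝ → ℝ) :
    ∫ n, f n ∂gauss = ∫ n, (√(2 * Real.pi))⁻¹ * Real.exp (-n ^ 2 / 2) * f n := by
  rw [integral_gaussianReal_eq_integral_smul one_ne_zero]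
  simp [gaussianPDFReal]

/-- In the limit the log-ratio is `N(-2β², 4β²)`; a shift of the Gaussian by `β` symmetrises the
mean of the sigmoid. -/
lemma integral_sigmoid_gauss (β : ℝ) :
    ∫ n, Real.sigmoid (-2 * β ^ 2 - 2 * β * n) ∂gauss = limitRate β := by
  rw [limitRate, sechMean, integral_gauss, integral_gauss, ← integral_const_mul,
    ← integral_sub_right_eq_self _ β]
  refine integral_congr_ae (ae_of_all _ fun n => ?_)
  have e1 : Real.sigmoid (-2 * β ^ 2 - 2 * β * (n - β))
      = Real.exp (-(β * n)) / 2 * (Real.cosh (β * n))⁻¹ := by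
    rw [Real.sigmoid_def, Real.cosh_eq]
    have : -(-2 * β ^ 2 - 2 * β * (n - β)) = β * n + β * n := by ring
    rw [this, Real.exp_add, Real.exp_neg]
    have := Real.exp_pos (β * n)
    field_simp
    ring
  have e2 : Real.exp (-(n - β) ^ 2 / 2) * Real.exp (-(β * n))
      = Real.exp (-n ^ 2 / 2) * Real.exp (-β ^ 2 / 2) := by
    rw [← Real.exp_add, ← Real.exp_add]; congr 1; ring
  simp only [e1]
  calc _ = (√(2 * Real.pi))⁻¹ * (Real.exp (-(n - β) ^ 2 / 2) * Real.exp (-(β * n))) / 2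
        * (Real.cosh (β * n))⁻¹ := by ring
    _ = _ := by rw [e2]; ring

/-! ### Moments of the norm and of the inner product -/

lemma integrable_norm_sq : Integrable (fun x : Euc d => ‖x‖ ^ 2) (stdGaussian (Euc d)) := by
  have h := (IsGaussian.memLp_id (stdGaussian (Euc d)) 2 (by simp)).integrable_norm_pow (by simp)
  simpa using h

lemma integrable_norm : Integrable (fun x : Euc d => ‖x‖) (stdGaussian (Euc d)) :=
  (IsGaussian.integrable_id (μ := stdGaussian (Euc d))).norm

lemma map_inner_stdGaussian {u : Euc d} (hu : ‖u‖ = 1) :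
    (stdGaussian (Euc d)).map (fun z => inner ℝ u z) = gauss := by
  have h2 := IsGaussian.map_eq_gaussianReal (μ := stdGaussian (Euc d)) (innerSL ℝ u)
  have h3 : (fun z => inner ℝ u z) = (innerSL ℝ u : Euc d → ℝ) := by
    ext z; simp
  rw [h3, h2, integral_strongDual_stdGaussian, variance_dual_stdGaussian]
  simp [hu]

lemma integral_sq_gauss : ∫ n, n ^ 2 ∂gauss = 1 := by
  have h := variance_fun_id_gaussianReal (μ := 0) (v := 1)
  rw [variance_of_integral_eq_zero (by fun_prop) (by simp)] at h
  simpa using h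

lemma integral_abs_gauss_le : ∫ n, |n| ∂gauss ≤ 1 := by
  have h2 : MemLp (fun n : ℝ => n) 2 gauss := memLp_id_gaussianReal 2
  calc ∫ n, |n| ∂gauss ≤ ∫ n, (n ^ 2 + 1) / 2 ∂gauss := by
        refine integral_mono (h2.integrable (by simp)).abs
          ((h2.integrable_sq.add (integrable_const 1)).div_const 2) fun n => ?_
        have := sq_nonneg (|n| - 1)
        simp only; nlinarith [sq_abs n]
    _ = 1 := by
        rw [integral_div, integral_add h2.integrable_sq (integrable_const 1), integral_sq_gauss]
        simp

lemma integral_abs_inner_le {u : Euc d} (hu : ‖u‖ = 1) :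
    ∫ z, |inner ℝ u z| ∂(stdGaussian (Euc d)) ≤ 1 := by
  rw [← integral_map (φ := fun z : Euc d => inner ℝ u z) (f := fun n : ℝ => |n|) (by fun_prop)
    (by fun_prop), map_inner_stdGaussian hu]
  exact integral_abs_gauss_le

lemma integral_stdGaussian_eq_pi (f : Euc d → ℝ) :
    ∫ x, f x ∂(stdGaussian (Euc d))
      = ∫ x, f (WithLp.toLp 2 x) ∂(Measure.pi fun _ : Fin d => gauss) := by
  rw [← map_pi_eq_stdGaussian]
  exact integral_map_equiv (MeasurableEquiv.toLp 2 (Fin d → ℝ)) f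

lemma integrable_gauss_pow (k : ℕ) : Integrable (fun n : ℝ => n ^ k) gauss := by
  have h := (memLp_id_gaussianReal (μ := 0) (v := 1) (k : ℝ≥0)).integrable_norm_pow'
  refine (integrable_norm_iff (by fun_prop)).1 ?_
  simpa using h

lemma integral_norm_sq : ∫ x, ‖x‖ ^ 2 ∂(stdGaussian (Euc d)) = d := by
  rw [integral_stdGaussian_eq_pi]
  simp only [EuclideanSpace.norm_sq_eq, Real.norm_eq_abs, sq_abs]
  rw [integral_finsetSum]
  · have hi : ∀ i : Fin d, ∫ x, (x i) ^ 2 ∂(Measure.pi fun _ : Fin d => gauss) = 1 := fun i =>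
      (integral_comp_eval (μ := fun _ : Fin d => gauss) (i := i) (f := fun n : ℝ => n ^ 2)
        (by fun_prop)).trans integral_sq_gauss
    simp [hi]
  · exact fun i _ => integrable_comp_eval (μ := fun _ : Fin d => gauss) (i := i)
      (f := fun n : ℝ => n ^ 2) (integrable_gauss_pow 2)

lemma integral_norm_le : ∫ x, ‖x‖ ∂(stdGaussian (Euc d)) ≤ √d := by
  rcases Nat.eq_zero_or_pos d with rfl | hd
  · have : ∀ x : Euc 0, ‖x‖ = 0 := fun x => by rw [Subsingleton.elim x 0, norm_zero]
    simp [this]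
  have hd' : 0 < √(d : ℝ) := Real.sqrt_pos.2 (by exact_mod_cast hd)
  calc ∫ x, ‖x‖ ∂(stdGaussian (Euc d)) ≤ ∫ x, (‖x‖ ^ 2 / √d + √d) / 2 ∂(stdGaussian (Euc d)) := by
        refine integral_mono integrable_norm
          (((integrable_norm_sq.div_const _).add (integrable_const _)).div_const 2) fun x => ?_
        have := sq_nonneg (‖x‖ - √d)
        simp only
        rw [le_div_iff₀ (by norm_num), div_add' _ _ _ hd'.ne', le_div_iff₀ hd']
        nlinarith
    _ = √d := by
        rw [integral_div, integral_add (integrable_norm_sq.div_const _) (integrable_const _),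
          integral_div, integral_norm_sq]
        simp

/-- The norm concentrates: `E |‖x‖² - d| = O(√d)`. -/
lemma exists_integral_abs_norm_sq_sub_le : ∃ κ : ℝ, 0 ≤ κ ∧ ∀ d : ℕ,
    ∫ x, |‖x‖ ^ 2 - d| ∂(stdGaussian (Euc d)) ≤ κ * √d := by
  set v : ℝ := Var[fun n : ℝ => n ^ 2; gauss]
  have hv : 0 ≤ v := variance_nonneg _ _
  refine ⟨(v + 1) / 2, by positivity, fun d => ?_⟩
  rcases Nat.eq_zero_or_pos d with rfl | hd
  · have : ∀ x : Euc 0, ‖x‖ = 0 := fun x => by rw [Subsingleton.elim x 0, norm_zero]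
    simp [this]
  have hd0 : (0 : ℝ) < d := by exact_mod_cast hd
  have hd' : 0 < √(d : ℝ) := Real.sqrt_pos.2 hd0
  have hm : MemLp (fun n : ℝ => n ^ 2) 2 gauss := by
    rw [memLp_two_iff_integrable_sq (by fun_prop)]
    simpa [← pow_mul] using integrable_gauss_pow 4
  have hvar := variance_sum_pi (ι := Fin d) (μ := fun _ => gauss) (X := fun _ n => n ^ 2)
    (fun _ => hm)
  have hsum : MemLp (∑ i : Fin d, fun ω : Fin d → ℝ => ω i ^ 2) 2
      (Measure.pi fun _ : Fin d => gauss) :=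
    memLp_finsetSum' _ fun i _ =>
      hm.comp_measurePreserving (measurePreserving_eval (fun _ : Fin d => gauss) i)
  have hmean : ∫ x, (∑ i : Fin d, fun ω : Fin d → ℝ => ω i ^ 2) x
      ∂(Measure.pi fun _ : Fin d => gauss) = d := by
    rw [← integral_norm_sq, integral_stdGaussian_eq_pi]
    simp [EuclideanSpace.norm_sq_eq]
  rw [variance_eq_integral hsum.aemeasurable, hmean] at hvar
  have hint : Integrable (fun x => ((∑ i : Fin d, fun ω : Fin d → ℝ => ω i ^ 2) x - (d : ℝ)) ^ 2)
      (Measure.pi fun _ : Fin d => gauss) := (hsum.sub (memLp_const (d : ℝ))).integrable_sq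
  simp only [Finset.sum_const, Finset.card_univ, Fintype.card_fin, nsmul_eq_mul] at hvar
  rw [integral_stdGaussian_eq_pi]
  calc ∫ x, |‖WithLp.toLp 2 x‖ ^ 2 - (d : ℝ)| ∂(Measure.pi fun _ : Fin d => gauss)
      ≤ ∫ x, (((∑ i : Fin d, fun ω : Fin d → ℝ => ω i ^ 2) x - d) ^ 2 / √d + √d) / 2
        ∂(Measure.pi fun _ : Fin d => gauss) := by
        refine integral_mono_of_nonneg (ae_of_all _ fun _ => abs_nonneg _)
          (((hint.div_const _).add (integrable_const _)).div_const 2) (ae_of_all _ fun x => ?_)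
        have e : ‖WithLp.toLp 2 x‖ ^ 2 = (∑ i : Fin d, fun ω : Fin d → ℝ => ω i ^ 2) x := by
          simp [EuclideanSpace.norm_sq_eq]
        simp only [e]
        generalize (∑ i : Fin d, fun ω : Fin d → ℝ => ω i ^ 2) x - d = t
        have := sq_nonneg (|t| - √d)
        rw [le_div_iff₀ (by norm_num), div_add' _ _ _ hd'.ne', le_div_iff₀ hd']
        nlinarith [sq_abs t]
    _ = (v + 1) / 2 * √d := by
        rw [integral_div, integral_add (hint.div_const _) (integrable_const _),
          integral_div]
        rw [hvar]
        simp only [integral_const, probReal_univ, smul_eq_mul, one_mul]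
        have : (d : ℝ) * v / √d = v * √d := by
          rw [mul_comm, mul_div_assoc, Real.div_sqrt]
        change ((d : ℝ) * v / √d + √d) / 2 = _
        rw [this]; ring

lemma integrable_abs_norm_sq_sub :
    Integrable (fun x : Euc d => |‖x‖ ^ 2 - d|) (stdGaussian (Euc d)) :=
  (integrable_norm_sq.sub (integrable_const _)).abs

lemma abs_norm_sub_sqrt_le (hd : 1 ≤ d) (x : Euc d) : |‖x‖ - √d| ≤ |‖x‖ ^ 2 - d| / √d := by
  have hd' : 0 < √(d : ℝ) := Real.sqrt_pos.2 (by exact_mod_cast hd)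
  rw [le_div_iff₀ hd']
  have e : ‖x‖ ^ 2 - d = (‖x‖ - √d) * (‖x‖ + √d) := by
    have := Real.sq_sqrt (Nat.cast_nonneg (α := ℝ) d)
    ring_nf; rw [this]
  rw [e, abs_mul, abs_of_pos (a := ‖x‖ + √d) (by positivity)]
  gcongr
  linarith [norm_nonneg x]

end BarkerLangevin

namespace BarkerLangevin

variable {d : ℕ}

/-! ### Comparison with the diffusion limit, with explicit errors -/

/-- `ESJD_d(h)` as a real number. -/
noncomputable def meanJump (d : ℕ) (h : ℝ) : ℝ := ∫ q, jumpIntegrand h q ∂(gaussPair d)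

/-- The stationary acceptance probability. -/
noncomputable def meanAccept (d : ℕ) (h : ℝ) : ℝ :=
  ∫ q, Real.sigmoid (logRatio h q.1 q.2) ∂(gaussPair d)

lemma abs_sigmoid_sub_le (a b : ℝ) : |Real.sigmoid a - Real.sigmoid b| ≤ |a - b| := by
  have h := Convex.norm_image_sub_le_of_norm_deriv_le (f := Real.sigmoid) (C := 1) (s := univ)
    (x := b) (y := a) (fun x _ => differentiable_sigmoid x) (fun x _ => by
      rw [Real.deriv_sigmoid, Real.norm_eq_abs, abs_le]
      have h0 := Real.sigmoid_nonneg x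
      have h1 := Real.sigmoid_le_one x
      constructor <;> nlinarith) convex_univ (mem_univ _) (mem_univ _)
  simpa using h

/-- The direction of `x`, with `e` in place of the undefined direction of `0`. -/
noncomputable def direction (e x : Euc d) : Euc d :=
  open Classical in if x = 0 then e else ‖x‖⁻¹ • x

lemma norm_direction {e : Euc d} (he : ‖e‖ = 1) (x : Euc d) : ‖direction e x‖ = 1 := by
  unfold direction
  split_ifs with h
  · exact he
  · rw [norm_smul, norm_inv, norm_norm, inv_mul_cancel₀ (norm_ne_zero_iff.2 h)]

lemma norm_mul_inner_direction (e x z : Euc d) :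
    ‖x‖ * inner ℝ (direction e x) z = inner ℝ x z := by
  unfold direction
  split_ifs with h
  · simp [h]
  · rw [real_inner_smul_left, mul_inv_cancel_left₀ (norm_ne_zero_iff.2 h)]

lemma measurable_direction (e : Euc d) : Measurable (direction e) := by
  unfold direction
  exact Measurable.ite (measurableSet_singleton 0) measurable_const (by fun_prop)

lemma measurable_inner_direction (e : Euc d) :
    Measurable fun q : Euc d × Euc d => inner ℝ (direction e q.1) q.2 :=
  ((measurable_direction e).comp measurable_fst).inner measurable_snd

lemma abs_inner_direction_le {e : Euc d} (he : ‖e‖ = 1) (x z : Euc d) :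
    |inner ℝ (direction e x) z| ≤ ‖z‖ := by
  simpa [norm_direction he] using abs_real_inner_le_norm (direction e x) z

lemma integrable_mul_abs_inner_direction {e : Euc d} (he : ‖e‖ = 1) {f : Euc d → ℝ}
    (hf : Integrable f (stdGaussian (Euc d))) :
    Integrable (fun q => f q.1 * |inner ℝ (direction e q.1) q.2|) (gaussPair d) := by
  refine (hf.mul_prod integrable_norm).mono
    (hf.aestronglyMeasurable.comp_fst.mul
      (measurable_inner_direction e).abs.aestronglyMeasurable) (ae_of_all _ fun q => ?_)
  rw [norm_mul, norm_mul, norm_norm, Real.norm_eq_abs |_|, abs_abs]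
  gcongr
  exact abs_inner_direction_le he _ _

lemma integral_mul_abs_inner_direction_le {e : Euc d} (he : ‖e‖ = 1) {f : Euc d → ℝ}
    (hf : Integrable f (stdGaussian (Euc d))) (hf0 : ∀ x, 0 ≤ f x) :
    ∫ q, f q.1 * |inner ℝ (direction e q.1) q.2| ∂(gaussPair d)
      ≤ ∫ x, f x ∂(stdGaussian (Euc d)) := by
  have hi := integrable_mul_abs_inner_direction he hf
  rw [integral_prod _ hi]
  refine integral_mono hi.integral_prod_left hf fun x => ?_
  simp only
  rw [integral_const_mul]
  exact mul_le_of_le_one_right (hf0 x) (integral_abs_inner_le (norm_direction he x))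

lemma integral_gaussPair_fst (f : Euc d → ℝ) :
    ∫ q, f q.1 ∂(gaussPair d) = ∫ x, f x ∂(stdGaussian (Euc d)) := by
  simpa using integral_fun_fst (μ := stdGaussian (Euc d)) (ν := stdGaussian (Euc d)) f

lemma integral_gaussPair_snd (f : Euc d → ℝ) :
    ∫ q, f q.2 ∂(gaussPair d) = ∫ x, f x ∂(stdGaussian (Euc d)) := by
  simpa using integral_fun_snd (μ := stdGaussian (Euc d)) (ν := stdGaussian (Euc d)) f

lemma integral_linear_combination_three {α : Type*} [MeasurableSpace α] {μ : Measure α}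
    {f g k : α → ℝ} (hf : Integrable f μ) (hg : Integrable g μ) (hk : Integrable k μ) (a b c : ℝ) :
    ∫ q, (a * f q + b * g q + c * k q) ∂μ
      = a * ∫ q, f q ∂μ + b * ∫ q, g q ∂μ + c * ∫ q, k q ∂μ := by
  rw [integral_add (f := fun q => a * f q + b * g q) ((hf.const_mul _).add (hg.const_mul _))
    (hk.const_mul _), integral_add (hf.const_mul _) (hg.const_mul _), integral_const_mul,
    integral_const_mul, integral_const_mul]

/-- `β = √(h³ d) / 8`, half the standard deviation of the limiting log-ratio. -/
noncomputable def scale (d : ℕ) (h : ℝ) : ℝ := h * √h * √d / 8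

/-- The log-ratio with `‖x‖²` and `‖z‖²` replaced by their mean `d`, `‖x‖` by `√d`, and the
coefficient `1 - h / 2` of the linear term by `1`. The inner product with the direction of `x` is a
standard Gaussian, so that the limit law is attained exactly for every `d`. -/
noncomputable def limitLogRatio (e : Euc d) (h : ℝ) (q : Euc d × Euc d) : ℝ :=
  -2 * scale d h ^ 2 - 2 * scale d h * inner ℝ (direction e q.1) q.2

lemma integrable_sigmoid {f : Euc d × Euc d → ℝ} (hf : Measurable f) :
    Integrable (fun q => Real.sigmoid (f q)) (gaussPair d) := by
  refine Integrable.of_bound (continuous_sigmoid.measurable.comp hf).aestronglyMeasurable 1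
    (ae_of_all _ fun q => ?_)
  rw [Real.norm_eq_abs, abs_of_nonneg (Real.sigmoid_nonneg _)]
  exact Real.sigmoid_le_one _

lemma measurable_limitLogRatio (e : Euc d) (h : ℝ) : Measurable (limitLogRatio e h) := by
  unfold limitLogRatio
  have := measurable_inner_direction e
  fun_prop

lemma integral_sigmoid_limitLogRatio {e : Euc d} (he : ‖e‖ = 1) (h : ℝ) :
    ∫ q, Real.sigmoid (limitLogRatio e h q) ∂(gaussPair d) = limitRate (scale d h) := by
  rw [integral_prod _ (integrable_sigmoid (measurable_limitLogRatio e h))]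
  have h1 : ∀ x : Euc d, ∫ z, Real.sigmoid (limitLogRatio e h (x, z)) ∂(stdGaussian (Euc d))
      = limitRate (scale d h) := by
    intro x
    rw [← integral_sigmoid_gauss, ← map_inner_stdGaussian (norm_direction he x),
      integral_map (by fun_prop)]
    · rfl
    · exact (continuous_sigmoid.comp (by fun_prop)).aestronglyMeasurable
  simp [h1]

/-- The total error of the acceptance rate; it is small when `h³ d` is bounded and `d` large. -/
noncomputable def rateError (κ : ℝ) (d : ℕ) (h : ℝ) : ℝ :=
  κ * √d * (h ^ 2 / 4 + h ^ 3 / 32) + h * √h / 4 * (κ + h / 2 * √d)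

lemma logRatio_sub_limitLogRatio (e : Euc d) {h : ℝ} (hh : 0 < h) (q : Euc d × Euc d) :
    logRatio h q.1 q.2 - limitLogRatio e h q
      = h ^ 2 / 8 * ((‖q.1‖ ^ 2 - d) - (‖q.2‖ ^ 2 - d)) - h ^ 3 / 32 * (‖q.1‖ ^ 2 - d)
        - h * √h / 4 * (((‖q.1‖ - √d) - h / 2 * ‖q.1‖) * inner ℝ (direction e q.1) q.2) := by
  have h1 : √h ^ 2 = h := Real.sq_sqrt hh.le
  have h2 : √(d : ℝ) ^ 2 = d := Real.sq_sqrt (Nat.cast_nonneg d)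
  have h3 : scale d h ^ 2 = h ^ 3 * d / 64 := by
    rw [scale, div_pow, mul_pow, mul_pow, h1, h2]; ring
  rw [logRatio_eq h hh.le, limitLogRatio, h3, ← norm_mul_inner_direction e q.1 q.2, scale]
  ring

/-- The acceptance rate is close to its diffusion limit: `σ` is Lipschitz, and the difference of the
log-ratios is small in mean. -/
theorem abs_meanAccept_sub_le {κ : ℝ} (hκ : ∀ d : ℕ,
    ∫ x, |‖x‖ ^ 2 - d| ∂(stdGaussian (Euc d)) ≤ κ * √d) (hd : 1 ≤ d) {h : ℝ} (hh : 0 < h) :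
    |meanAccept d h - limitRate (scale d h)| ≤ rateError κ d h := by
  obtain ⟨e, he⟩ : ∃ e : Euc d, ‖e‖ = 1 :=
    ⟨EuclideanSpace.single ⟨0, hd⟩ 1, by simp⟩
  have hd0 : 0 < √(d : ℝ) := Real.sqrt_pos.2 (by exact_mod_cast hd)
  rw [meanAccept, ← integral_sigmoid_limitLogRatio he h, ← integral_sub
    (integrable_sigmoid (continuous_logRatio h).measurable)
    (integrable_sigmoid (measurable_limitLogRatio e h))]
  set W : Euc d → ℝ := fun x => |‖x‖ ^ 2 - d| with hW
  have iW : Integrable W (stdGaussian (Euc d)) := integrable_abs_norm_sq_sub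
  set f : Euc d → ℝ := fun x => W x / √d + h / 2 * ‖x‖ with hf
  have iF : Integrable f (stdGaussian (Euc d)) :=
    (iW.div_const _).add (integrable_norm.const_mul _)
  have hf0 : ∀ x, 0 ≤ f x := fun x => by
    have : 0 ≤ W x := abs_nonneg _
    positivity
  set N : Euc d × Euc d → ℝ := fun q => |inner ℝ (direction e q.1) q.2| with hN
  have iN := integrable_mul_abs_inner_direction he iF
  have i1 : Integrable (fun q : Euc d × Euc d => W q.1) (gaussPair d) := iW.comp_fst _
  have i2 : Integrable (fun q : Euc d × Euc d => W q.2) (gaussPair d) := iW.comp_snd _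
  calc |∫ q, (Real.sigmoid (logRatio h q.1 q.2) - Real.sigmoid (limitLogRatio e h q))
        ∂(gaussPair d)|
      ≤ ∫ q, |Real.sigmoid (logRatio h q.1 q.2) - Real.sigmoid (limitLogRatio e h q)|
        ∂(gaussPair d) := abs_integral_le_integral_abs
    _ ≤ ∫ q, ((h ^ 2 / 8 + h ^ 3 / 32) * W q.1 + h ^ 2 / 8 * W q.2
        + h * √h / 4 * (f q.1 * N q)) ∂(gaussPair d) := by
        refine integral_mono_of_nonneg (ae_of_all _ fun _ => abs_nonneg _)
          (((i1.const_mul _).add (i2.const_mul _)).add (iN.const_mul _)) (ae_of_all _ fun q => ?_)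
        refine (abs_sigmoid_sub_le _ _).trans ?_
        rw [logRatio_sub_limitLogRatio e hh q]
        have t1 : |(‖q.1‖ - √d) - h / 2 * ‖q.1‖| ≤ f q.1 := by
          refine (abs_sub _ _).trans ?_
          rw [abs_of_nonneg (a := h / 2 * ‖q.1‖) (by positivity)]
          exact add_le_add_left (abs_norm_sub_sqrt_le hd q.1) _
        have t2 : |((‖q.1‖ - √d) - h / 2 * ‖q.1‖) * inner ℝ (direction e q.1) q.2|
            ≤ f q.1 * N q := by
          rw [abs_mul]; gcongr
        have p2 : 0 < h ^ 2 / 8 := by positivity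
        have p3 : 0 < h ^ 3 / 32 := by positivity
        have p4 : 0 < h * √h / 4 := by have := Real.sqrt_pos.2 hh; positivity
        have s1 := abs_le.1 (le_refl (W q.1))
        have a1 := abs_le.1 (le_refl |‖q.1‖ ^ 2 - d|)
        have a2 := abs_le.1 (le_refl |‖q.2‖ ^ 2 - d|)
        have a3 := abs_le.1 t2
        rw [abs_le]
        simp only [hW]
        constructor
        · nlinarith [mul_le_mul_of_nonneg_left a1.1 p2.le, mul_le_mul_of_nonneg_left a2.2 p2.le,
            mul_le_mul_of_nonneg_left a1.2 p3.le, mul_le_mul_of_nonneg_left a3.2 p4.le]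
        · nlinarith [mul_le_mul_of_nonneg_left a1.2 p2.le, mul_le_mul_of_nonneg_left a2.1 p2.le,
            mul_le_mul_of_nonneg_left a1.1 p3.le, mul_le_mul_of_nonneg_left a3.1 p4.le]
    _ = (h ^ 2 / 8 + h ^ 3 / 32) * ∫ x, W x ∂(stdGaussian (Euc d))
        + h ^ 2 / 8 * ∫ x, W x ∂(stdGaussian (Euc d))
        + h * √h / 4 * ∫ q, f q.1 * N q ∂(gaussPair d) := by
        rw [integral_linear_combination_three i1 i2 iN, integral_gaussPair_fst W,
          integral_gaussPair_snd W]
    _ ≤ (h ^ 2 / 8 + h ^ 3 / 32) * (κ * √d) + h ^ 2 / 8 * (κ * √d)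
        + h * √h / 4 * (κ + h / 2 * √d) := by
        have b1 := hκ d
        have b2 : ∫ q, f q.1 * N q ∂(gaussPair d) ≤ κ + h / 2 * √d := by
          refine (integral_mul_abs_inner_direction_le he iF hf0).trans ?_
          rw [integral_add (iW.div_const _) (integrable_norm.const_mul _), integral_div,
            integral_const_mul]
          gcongr
          · rw [div_le_iff₀ hd0]; exact b1
          · exact integral_norm_le
        gcongr
    _ = rateError κ d h := by rw [rateError]; ring

lemma integrable_norm_sq_prop_sub {h : ℝ} (hh : 0 ≤ h) :
    Integrable (fun q : Euc d × Euc d => ‖prop h q.1 q.2 - q.1‖ ^ 2) (gaussPair d) := by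
  have i1 : Integrable (fun q : Euc d × Euc d => ‖q.1‖ ^ 2) (gaussPair d) :=
    integrable_norm_sq.comp_fst _
  have i2 : Integrable (fun q : Euc d × Euc d => ‖q.2‖ ^ 2) (gaussPair d) :=
    integrable_norm_sq.comp_snd _
  have i3 : Integrable (fun q : Euc d × Euc d => inner ℝ q.1 q.2) (gaussPair d) := by
    refine (i1.add i2).mono' (by fun_prop) (ae_of_all _ fun q => ?_)
    have := abs_real_inner_le_norm q.1 q.2
    simp only [Pi.add_apply, Real.norm_eq_abs]
    nlinarith [sq_nonneg (‖q.1‖ - ‖q.2‖), norm_nonneg q.1, norm_nonneg q.2]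
  simp_rw [norm_sq_prop_sub h hh]
  exact ((i1.const_mul _).sub (i3.const_mul _)).add (i2.const_mul _)

lemma integrable_jumpIntegrand {h : ℝ} (hh : 0 ≤ h) :
    Integrable (jumpIntegrand h) (gaussPair d) := by
  refine (integrable_norm_sq_prop_sub hh).mono'
    (continuous_jumpIntegrand h).aestronglyMeasurable (ae_of_all _ fun q => ?_)
  rw [Real.norm_eq_abs, abs_of_nonneg (jumpIntegrand_nonneg h q)]
  exact mul_le_of_le_one_right (by positivity) (Real.sigmoid_le_one _)

/-- The squared jump is close in mean to `h d`, so the expected squared jump is close to `h d` times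
the acceptance rate. -/
theorem abs_meanJump_sub_le {κ : ℝ} (hκ : ∀ d : ℕ,
    ∫ x, |‖x‖ ^ 2 - d| ∂(stdGaussian (Euc d)) ≤ κ * √d) (hd : 1 ≤ d) {h : ℝ} (hh : 0 < h) :
    |meanJump d h - h * d * limitRate (scale d h)|
      ≤ h ^ 2 / 4 * d + h * √h * √d + h * (κ * √d) + h * d * rateError κ d h := by
  obtain ⟨e, he⟩ : ∃ e : Euc d, ‖e‖ = 1 :=
    ⟨EuclideanSpace.single ⟨0, hd⟩ 1, by simp⟩
  have hsplit : meanJump d h - h * d * limitRate (scale d h)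
      = ∫ q, (‖prop h q.1 q.2 - q.1‖ ^ 2 - h * d) * Real.sigmoid (logRatio h q.1 q.2)
          ∂(gaussPair d)
        + h * d * (meanAccept d h - limitRate (scale d h)) := by
    have : ∀ q : Euc d × Euc d,
        (‖prop h q.1 q.2 - q.1‖ ^ 2 - h * d) * Real.sigmoid (logRatio h q.1 q.2)
        = jumpIntegrand h q - h * d * Real.sigmoid (logRatio h q.1 q.2) := by
      intro q; rw [jumpIntegrand]; ring
    simp_rw [this]
    rw [integral_sub (integrable_jumpIntegrand hh.le)
      ((integrable_sigmoid (continuous_logRatio h).measurable).const_mul _), integral_const_mul,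
      meanJump, meanAccept]
    ring
  set W : Euc d → ℝ := fun x => |‖x‖ ^ 2 - d| with hW
  have iW : Integrable W (stdGaussian (Euc d)) := integrable_abs_norm_sq_sub
  have i1 : Integrable (fun q : Euc d × Euc d => ‖q.1‖ ^ 2) (gaussPair d) :=
    integrable_norm_sq.comp_fst _
  have i2 : Integrable (fun q : Euc d × Euc d => W q.2) (gaussPair d) := iW.comp_snd _
  set N : Euc d × Euc d → ℝ := fun q => |inner ℝ (direction e q.1) q.2| with hN
  have iN := integrable_mul_abs_inner_direction he (integrable_norm (d := d))
  have key : |∫ q, (‖prop h q.1 q.2 - q.1‖ ^ 2 - h * d) * Real.sigmoid (logRatio h q.1 q.2)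
          ∂(gaussPair d)| ≤ h ^ 2 / 4 * d + h * √h * √d + h * (κ * √d) := by
    calc _ ≤ ∫ q, |(‖prop h q.1 q.2 - q.1‖ ^ 2 - h * d) * Real.sigmoid (logRatio h q.1 q.2)|
          ∂(gaussPair d) := abs_integral_le_integral_abs
      _ ≤ ∫ q, (h ^ 2 / 4 * ‖q.1‖ ^ 2 + h * √h * (‖q.1‖ * N q) + h * W q.2) ∂(gaussPair d) := by
          refine integral_mono_of_nonneg (ae_of_all _ fun _ => abs_nonneg _)
            (((i1.const_mul _).add (iN.const_mul _)).add (i2.const_mul _))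
            (ae_of_all _ fun q => ?_)
          simp only
          rw [abs_mul, abs_of_nonneg (Real.sigmoid_nonneg _)]
          refine (mul_le_of_le_one_right (abs_nonneg _) (Real.sigmoid_le_one _)).trans ?_
          have e1 : ‖prop h q.1 q.2 - q.1‖ ^ 2 - h * d = h ^ 2 / 4 * ‖q.1‖ ^ 2
              - h * √h * (‖q.1‖ * inner ℝ (direction e q.1) q.2) + h * (‖q.2‖ ^ 2 - d) := by
            rw [norm_sq_prop_sub h hh.le, norm_mul_inner_direction]; ring
          rw [e1]
          refine (abs_add_le _ _).trans (add_le_add ((abs_sub _ _).trans (add_le_add ?_ ?_)) ?_)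
          · rw [abs_of_nonneg (by positivity)]
          · rw [abs_mul, abs_mul ‖q.1‖, abs_norm, abs_of_nonneg (by positivity)]
          · rw [abs_mul, abs_of_pos hh]
      _ = h ^ 2 / 4 * d + h * √h * ∫ q, ‖q.1‖ * N q ∂(gaussPair d)
          + h * ∫ x, W x ∂(stdGaussian (Euc d)) := by
          rw [integral_linear_combination_three i1 iN i2,
            integral_gaussPair_fst (fun x : Euc d => ‖x‖ ^ 2), integral_gaussPair_snd W,
            integral_norm_sq]
      _ ≤ _ := by
          have b2 : ∫ q, ‖q.1‖ * N q ∂(gaussPair d) ≤ √d :=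
            (integral_mul_abs_inner_direction_le he integrable_norm fun _ => norm_nonneg _).trans
              integral_norm_le
          have b1 := hκ d
          gcongr
  rw [hsplit]
  refine (abs_add_le _ _).trans (add_le_add key ?_)
  rw [abs_mul, abs_of_nonneg (by positivity : 0 ≤ h * (d : ℝ))]
  gcongr
  exact abs_meanAccept_sub_le hκ hd hh

end BarkerLangevin

namespace BarkerLangevin

variable {d : ℕ}

/-! ### Existence of an optimal step size -/

lemma meanJump_nonneg (d : ℕ) (h : ℝ) : 0 ≤ meanJump d h :=
  integral_nonneg fun q => jumpIntegrand_nonneg h q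

lemma lintegral_jumpIntegrand {h : ℝ} (hh : 0 ≤ h) :
    ∫⁻ q, ENNReal.ofReal (jumpIntegrand h q) ∂(gaussPair d) = ENNReal.ofReal (meanJump d h) :=
  (ofReal_integral_eq_lintegral_ofReal (integrable_jumpIntegrand hh)
    (ae_of_all _ fun q => jumpIntegrand_nonneg h q)).symm

lemma meanJump_le (d : ℕ) {h : ℝ} (hh : 0 < h) :
    meanJump d h ≤ 8 * h * d / √(1 + d * h ^ 3 / 64) := by
  rcases Nat.eq_zero_or_pos d with rfl | hd
  · have : ∀ q : Euc 0 × Euc 0, jumpIntegrand h q = 0 := fun q => by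
      rw [jumpIntegrand, Subsingleton.elim (prop h q.1 q.2 - q.1) 0]; simp
    simp [meanJump, this]
  · have h1 := lintegral_jumpIntegrand_le hd hh
    rw [lintegral_jumpIntegrand hh.le] at h1
    exact (ENNReal.ofReal_le_ofReal_iff (by positivity)).1 h1

lemma meanJump_le_mul (d : ℕ) {h : ℝ} (hh : 0 < h) : meanJump d h ≤ 8 * h * d := by
  refine (meanJump_le d hh).trans (div_le_self (by positivity) ?_)
  rw [Real.one_le_sqrt]
  have : 0 ≤ d * h ^ 3 := by positivity
  linarith

lemma meanJump_le_div (d : ℕ) {h : ℝ} (hh : 0 < h) : meanJump d h ≤ 64 * √d / √h := by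
  rcases Nat.eq_zero_or_pos d with rfl | hd
  · simpa using meanJump_le 0 hh
  have hd0 : (0 : ℝ) < d := by exact_mod_cast hd
  have p1 := Real.sqrt_pos.2 hh
  have p2 := Real.sqrt_pos.2 hd0
  have e : √(d * h ^ 3 / 64) = √d * (h * √h) / 8 := by
    have : d * h ^ 3 / 64 = (√d * (h * √h) / 8) ^ 2 := by
      rw [div_pow, mul_pow, mul_pow, Real.sq_sqrt hd0.le, Real.sq_sqrt hh.le]; ring
    rw [this, Real.sqrt_sq (by positivity)]
  refine (meanJump_le d hh).trans ?_
  calc 8 * h * d / √(1 + d * h ^ 3 / 64) ≤ 8 * h * d / √(d * h ^ 3 / 64) := by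
        gcongr
        linarith
    _ = 64 * √d / √h := by
        rw [e]
        have h1 := Real.mul_self_sqrt hd0.le
        field_simp
        nlinarith

lemma norm_sq_prop_sub_le {h M : ℝ} (h0 : 0 ≤ h) (hM : h ≤ M) (x z : Euc d) :
    ‖prop h x z - x‖ ^ 2 ≤ M ^ 2 / 2 * ‖x‖ ^ 2 + 2 * M * ‖z‖ ^ 2 := by
  have e : prop h x z - x = (-(h / 2)) • x + √h • z := by rw [prop]; module
  have h1 := parallelogram_law_with_norm ℝ ((-(h / 2)) • x) (√h • z)
  have h2 : 0 ≤ ‖(-(h / 2)) • x - √h • z‖ := norm_nonneg _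
  have h3 : ‖(-(h / 2)) • x‖ * ‖(-(h / 2)) • x‖ = h ^ 2 / 4 * ‖x‖ ^ 2 := by
    rw [norm_smul, Real.norm_eq_abs, abs_neg, abs_of_nonneg (by linarith)]; ring
  have h4 : ‖√h • z‖ * ‖√h • z‖ = h * ‖z‖ ^ 2 := by
    rw [norm_smul, Real.norm_eq_abs, abs_of_nonneg (Real.sqrt_nonneg _)]
    calc _ = (√h * √h) * ‖z‖ ^ 2 := by ring
      _ = _ := by rw [Real.mul_self_sqrt h0]
  have h5 : h ^ 2 ≤ M ^ 2 := pow_le_pow_left₀ h0 hM 2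
  have h6 : 0 ≤ ‖x‖ ^ 2 := by positivity
  have h7 : 0 ≤ ‖z‖ ^ 2 := by positivity
  rw [e]
  nlinarith [mul_le_mul_of_nonneg_right h5 h6, mul_le_mul_of_nonneg_right hM h7]

lemma continuousOn_meanJump (d : ℕ) : ContinuousOn (meanJump d) (Ioi 0) := by
  intro h₀ hh₀
  refine ContinuousAt.continuousWithinAt ?_
  have hnb : ∀ᶠ h in 𝓝 h₀, 0 < h ∧ h < h₀ + 1 :=
    (lt_mem_nhds hh₀).and (gt_mem_nhds (by linarith))
  refine continuousAt_of_dominated (F := fun h q => jumpIntegrand h q)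
    (bound := fun q => (h₀ + 1) ^ 2 / 2 * ‖q.1‖ ^ 2 + 2 * (h₀ + 1) * ‖q.2‖ ^ 2)
    (Eventually.of_forall fun h => (continuous_jumpIntegrand h).aestronglyMeasurable) ?_
    ((integrable_norm_sq.comp_fst _).const_mul _ |>.add
      ((integrable_norm_sq.comp_snd _).const_mul _)) (ae_of_all _ fun q => ?_)
  · filter_upwards [hnb] with h hh
    refine ae_of_all _ fun q => ?_
    rw [Real.norm_eq_abs, abs_of_nonneg (jumpIntegrand_nonneg h q)]
    exact (mul_le_of_le_one_right (by positivity) (Real.sigmoid_le_one _)).trans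
      (norm_sq_prop_sub_le hh.1.le hh.2.le _ _)
  · refine Continuous.continuousAt ?_
    have c1 : Continuous fun h => prop h q.1 q.2 := by unfold prop; fun_prop
    have c2 : Continuous fun h => logRatio h q.1 q.2 := by unfold logRatio; fun_prop
    exact ((c1.sub continuous_const).norm.pow 2).mul (continuous_sigmoid.comp c2)

/-- The mean jump is continuous and tends to `0` at `0` and at infinity, so that it attains its
maximum. -/
lemma exists_isMaxOn_meanJump (d : ℕ) : ∃ h, 0 < h ∧ IsMaxOn (meanJump d) (Ioi 0) h := by
  -- In dimension `0` the mean jump vanishes and every step size is optimal.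
  by_cases hall : ∀ h, 0 < h → meanJump d h ≤ 0
  · exact ⟨1, one_pos, fun h hh => (hall h hh).trans (meanJump_nonneg d 1)⟩
  push Not at hall
  obtain ⟨h₀, hh₀, hm⟩ := hall
  set m := meanJump d h₀
  have hd : (0 : ℝ) < d := by
    by_contra hd
    have := meanJump_le_mul d hh₀
    have : 8 * h₀ * (d : ℝ) ≤ 0 := mul_nonpos_of_nonneg_of_nonpos (by positivity) (by linarith)
    linarith
  set δ := m / (8 * d) with hδ
  set M := (64 * √d / m) ^ 2 with hM
  have hδ0 : 0 < δ := by positivity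
  have hsd := Real.sqrt_pos.2 hd
  have hM0 : 0 < M := by positivity
  have hin : ∀ h, 0 < h → m ≤ meanJump d h → h ∈ Icc δ M := by
    intro h hh hmh
    constructor
    · have := hmh.trans (meanJump_le_mul d hh)
      rw [hδ, div_le_iff₀ (by positivity)]; linarith
    · have h1 := hmh.trans (meanJump_le_div d hh)
      have hs := Real.sqrt_pos.2 hh
      rw [le_div_iff₀ hs] at h1
      have h2 : √h ≤ 64 * √d / m := by rw [le_div_iff₀ hm]; linarith
      calc h = √h ^ 2 := (Real.sq_sqrt hh.le).symm
        _ ≤ M := by rw [hM]; gcongr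
  obtain ⟨h₁, hh₁, hmax⟩ := isCompact_Icc.exists_isMaxOn ⟨h₀, hin h₀ hh₀ le_rfl⟩
    ((continuousOn_meanJump d).mono fun h hh => lt_of_lt_of_le hδ0 hh.1)
  refine ⟨h₁, lt_of_lt_of_le hδ0 hh₁.1, fun h hh => ?_⟩
  by_cases hc : m ≤ meanJump d h
  · exact hmax (hin h hh hc)
  · exact (not_le.1 hc).le.trans (hmax (hin h₀ hh₀ le_rfl))

section
variable {s : Euc d → Euc d} {C : Euc d → Euc d → ℝ}

lemma isOptimalStep_iff (hs : ∀ x, s x = -x) (hC : IsScoreBound s C) (h : ℝ) :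
    IsOptimalStep (stdDensity d) s C h ↔ 0 < h ∧ IsMaxOn (meanJump d) (Ioi 0) h := by
  have e : ∀ h, 0 < h → esjd (stdDensity d) s C h = ENNReal.ofReal (meanJump d h) := fun h hh => by
    rw [esjd_eq hs hC hh, lintegral_jumpIntegrand hh.le]
  refine and_congr_right fun hh => ?_
  simp only [isMaxOn_iff, mem_Ioi]
  refine forall₂_congr fun h' hh' => ?_
  rw [e h hh, e h' hh', ENNReal.ofReal_le_ofReal_iff (meanJump_nonneg d h)]

end
end BarkerLangevin

namespace BarkerLangevin

/-! ### The limiting efficiency is strictly unimodal -/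

/-- `L β = E (N² / cosh (β N))` for a standard Gaussian `N`. -/
noncomputable def sechSecondMoment (β : ℝ) : ℝ := ∫ n, n ^ 2 * (Real.cosh (β * n))⁻¹ ∂gauss

lemma inv_cosh_pos (t : ℝ) : 0 < (Real.cosh t)⁻¹ := inv_pos.2 (Real.cosh_pos t)

lemma inv_cosh_le_one (t : ℝ) : (Real.cosh t)⁻¹ ≤ 1 :=
  inv_le_one_of_one_le₀ (Real.one_le_cosh t)

lemma continuous_inv_cosh : Continuous fun t : ℝ => (Real.cosh t)⁻¹ :=
  Real.continuous_cosh.inv₀ fun t => (Real.cosh_pos t).ne'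

lemma integrable_pow_mul_inv_cosh (k : ℕ) (β : ℝ) :
    Integrable (fun n => n ^ k * (Real.cosh (β * n))⁻¹) gauss := by
  refine (integrable_gauss_pow k).mono
    ((by fun_prop : Continuous fun n : ℝ => n ^ k).mul
      (continuous_inv_cosh.comp (by fun_prop : Continuous fun n : ℝ => β * n))).aestronglyMeasurable
    (ae_of_all _ fun n => ?_)
  rw [norm_mul, Real.norm_eq_abs (Real.cosh _)⁻¹, abs_of_pos (inv_cosh_pos _)]
  exact mul_le_of_le_one_right (norm_nonneg _) (inv_cosh_le_one _)

lemma integrable_inv_cosh (β : ℝ) : Integrable (fun n => (Real.cosh (β * n))⁻¹) gauss := by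
  simpa using integrable_pow_mul_inv_cosh 0 β

lemma sechMean_pos (β : ℝ) : 0 < sechMean β := by
  rw [sechMean, integral_pos_iff_support_of_nonneg (fun n => (inv_cosh_pos _).le)
    (integrable_inv_cosh β)]
  have : Function.support (fun n : ℝ => (Real.cosh (β * n))⁻¹) = univ := by
    ext n; simpa using (inv_cosh_pos (β * n)).ne'
  rw [this]; simp

/-- `cosh (β₁ n) / cosh (β₂ n)` decreases in `|n|`. -/
lemma cosh_mul_cosh_le {β₁ β₂ m n : ℝ} (h1 : 0 ≤ β₁) (h12 : β₁ ≤ β₂) (hmn : |m| ≤ |n|) :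
    Real.cosh (β₁ * n) * Real.cosh (β₂ * m) ≤ Real.cosh (β₁ * m) * Real.cosh (β₂ * n) := by
  wlog hm : 0 ≤ m generalizing m
  · have := this (m := -m) (by rwa [abs_neg]) (by linarith)
    simpa using this
  wlog hn : 0 ≤ n generalizing n
  · have := this (n := -n) (by rwa [abs_neg]) (by linarith)
    simpa using this
  rw [abs_of_nonneg hm, abs_of_nonneg hn] at hmn
  have h2 : 0 ≤ β₂ := h1.trans h12
  have p : ∀ a b : ℝ, Real.cosh a * Real.cosh b = (Real.cosh (a + b) + Real.cosh (a - b)) / 2 := by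
    intro a b; rw [Real.cosh_add, Real.cosh_sub]; ring
  rw [p, p]
  have c1 : Real.cosh (β₁ * n + β₂ * m) ≤ Real.cosh (β₁ * m + β₂ * n) := by
    rw [Real.cosh_le_cosh, abs_of_nonneg (by positivity), abs_of_nonneg (by positivity)]
    nlinarith
  have c2 : Real.cosh (β₁ * n - β₂ * m) ≤ Real.cosh (β₁ * m - β₂ * n) := by
    rw [Real.cosh_le_cosh, ← sq_le_sq]
    nlinarith [mul_nonneg (mul_nonneg (sub_nonneg.2 h12) (add_nonneg h1 h2))
      (mul_nonneg (sub_nonneg.2 hmn) (add_nonneg hm hn))]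
  linarith

/-- The second moment of `N` under the weight `1 / cosh (β N)` decreases in `β`, by Chebyshev's
association inequality: the likelihood ratio of two such weights is monotone in `|N|`. -/
lemma sechSecondMoment_mul_le {β₁ β₂ : ℝ} (h1 : 0 ≤ β₁) (h12 : β₁ ≤ β₂) :
    sechSecondMoment β₂ * sechMean β₁ ≤ sechSecondMoment β₁ * sechMean β₂ := by
  set s₁ : ℝ → ℝ := fun n => (Real.cosh (β₁ * n))⁻¹ with hs₁
  set s₂ : ℝ → ℝ := fun n => (Real.cosh (β₂ * n))⁻¹ with hs₂
  have hpt : ∀ q : ℝ × ℝ, 0 ≤ (q.1 ^ 2 - q.2 ^ 2) * (s₁ q.1 * s₂ q.2 - s₁ q.2 * s₂ q.1) := by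
    intro q
    have key : ∀ m n : ℝ, |m| ≤ |n| → 0 ≤ s₁ n * s₂ m - s₁ m * s₂ n := by
      intro m n hmn
      rw [sub_nonneg]
      simp only [hs₁, hs₂, ← mul_inv]
      exact inv_anti₀ (mul_pos (Real.cosh_pos _) (Real.cosh_pos _)) (cosh_mul_cosh_le h1 h12 hmn)
    rcases le_total |q.2| |q.1| with h | h
    · exact mul_nonneg (sub_nonneg.2 (sq_le_sq.2 h)) (key _ _ h)
    · have := key _ _ h
      exact mul_nonneg_of_nonpos_of_nonpos (sub_nonpos.2 (sq_le_sq.2 h)) (by linarith)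
  have i0 := integrable_inv_cosh
  have i2 := integrable_pow_mul_inv_cosh 2
  have hI := integral_nonneg (μ := gauss.prod gauss) (f := fun q : ℝ × ℝ =>
    (q.1 ^ 2 - q.2 ^ 2) * (s₁ q.1 * s₂ q.2 - s₁ q.2 * s₂ q.1)) hpt
  have hexp : ∀ q : ℝ × ℝ, (q.1 ^ 2 - q.2 ^ 2) * (s₁ q.1 * s₂ q.2 - s₁ q.2 * s₂ q.1)
      = (q.1 ^ 2 * s₁ q.1) * s₂ q.2 + s₂ q.1 * (q.2 ^ 2 * s₁ q.2)
        - ((q.1 ^ 2 * s₂ q.1) * s₁ q.2 + s₁ q.1 * (q.2 ^ 2 * s₂ q.2)) := fun q => by ring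
  simp_rw [hexp] at hI
  have j1 : Integrable (fun q : ℝ × ℝ => (q.1 ^ 2 * s₁ q.1) * s₂ q.2) (gauss.prod gauss) :=
    (i2 β₁).mul_prod (i0 β₂)
  have j2 : Integrable (fun q : ℝ × ℝ => s₂ q.1 * (q.2 ^ 2 * s₁ q.2)) (gauss.prod gauss) :=
    (i0 β₂).mul_prod (i2 β₁)
  have j3 : Integrable (fun q : ℝ × ℝ => (q.1 ^ 2 * s₂ q.1) * s₁ q.2) (gauss.prod gauss) :=
    (i2 β₂).mul_prod (i0 β₁)
  have j4 : Integrable (fun q : ℝ × ℝ => s₁ q.1 * (q.2 ^ 2 * s₂ q.2)) (gauss.prod gauss) :=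
    (i0 β₁).mul_prod (i2 β₂)
  have j12 : Integrable (fun q : ℝ × ℝ => (q.1 ^ 2 * s₁ q.1) * s₂ q.2
    + s₂ q.1 * (q.2 ^ 2 * s₁ q.2)) (gauss.prod gauss) := j1.add j2
  have j34 : Integrable (fun q : ℝ × ℝ => (q.1 ^ 2 * s₂ q.1) * s₁ q.2
    + s₁ q.1 * (q.2 ^ 2 * s₂ q.2)) (gauss.prod gauss) := j3.add j4
  rw [integral_sub j12 j34, integral_add j1 j2, integral_add j3 j4,
    integral_prod_mul (fun n => n ^ 2 * s₁ n) s₂, integral_prod_mul s₂ (fun n => n ^ 2 * s₁ n),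
    integral_prod_mul (fun n => n ^ 2 * s₂ n) s₁, integral_prod_mul s₁ (fun n => n ^ 2 * s₂ n)]
    at hI
  change 0 ≤ sechSecondMoment β₁ * sechMean β₂ + sechMean β₂ * sechSecondMoment β₁
    - (sechSecondMoment β₂ * sechMean β₁ + sechMean β₁ * sechSecondMoment β₂) at hI
  linarith

/-- `∫ t^k e^{-b t²} / cosh t dt`. -/
noncomputable def sechIntegral (k : ℕ) (b : ℝ) : ℝ :=
  ∫ t : ℝ, t ^ k * Real.exp (-b * t ^ 2) * (Real.cosh t)⁻¹

lemma integrable_pow_mul_exp_neg_mul_sq (k : ℕ) {b : ℝ} (hb : 0 < b) :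
    Integrable fun t : ℝ => t ^ k * Real.exp (-b * t ^ 2) := by
  have := integrable_rpow_mul_exp_neg_mul_sq hb (s := k)
    (by have : (0 : ℝ) ≤ k := Nat.cast_nonneg k
        linarith)
  simpa using this

lemma continuous_sechIntegrand (k : ℕ) (b : ℝ) :
    Continuous fun t : ℝ => t ^ k * Real.exp (-b * t ^ 2) * (Real.cosh t)⁻¹ :=
  (by fun_prop : Continuous fun t : ℝ => t ^ k * Real.exp (-b * t ^ 2)).mul continuous_inv_cosh

lemma hasDerivAt_sechIntegral {b : ℝ} (hb : 0 < b) :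
    HasDerivAt (sechIntegral 0) (-sechIntegral 2 b) b := by
  have h := hasDerivAt_integral_of_dominated_loc_of_deriv_le (μ := volume) (x₀ := b)
    (s := Ioi (b / 2))
    (F := fun b t => t ^ 0 * Real.exp (-b * t ^ 2) * (Real.cosh t)⁻¹)
    (F' := fun b t => -(t ^ 2 * Real.exp (-b * t ^ 2) * (Real.cosh t)⁻¹))
    (bound := fun t => t ^ 2 * Real.exp (-(b / 2) * t ^ 2))
    (Ioi_mem_nhds (by linarith))
    (Eventually.of_forall fun b => (continuous_sechIntegrand 0 b).aestronglyMeasurable)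
    ?_ (continuous_sechIntegrand 2 b).neg.aestronglyMeasurable ?_
    (integrable_pow_mul_exp_neg_mul_sq 2 (by linarith)) ?_
  · have h2 := h.2
    rw [integral_neg] at h2
    exact h2
  · refine (integrable_pow_mul_exp_neg_mul_sq 0 hb).mono
      (continuous_sechIntegrand 0 b).aestronglyMeasurable (ae_of_all _ fun t => ?_)
    rw [norm_mul, Real.norm_eq_abs (Real.cosh _)⁻¹, abs_of_pos (inv_cosh_pos _)]
    exact mul_le_of_le_one_right (norm_nonneg _) (inv_cosh_le_one _)
  · refine ae_of_all _ fun t b' hb' => ?_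
    rw [norm_neg, Real.norm_eq_abs, abs_of_nonneg (mul_nonneg (by positivity) (inv_cosh_pos _).le)]
    refine (mul_le_of_le_one_right (by positivity) (inv_cosh_le_one _)).trans ?_
    have : b / 2 < b' := hb'
    gcongr
  · refine ae_of_all _ fun t b' _ => ?_
    have h1 : HasDerivAt (fun b : ℝ => Real.exp (-b * t ^ 2))
        (Real.exp (-b' * t ^ 2) * (-1 * t ^ 2)) b' :=
      ((hasDerivAt_id b').neg.mul_const (t ^ 2)).exp
    have h2 := (h1.const_mul (t ^ 0)).mul_const (Real.cosh t)⁻¹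
    exact h2.congr_deriv (by ring)

/-- The substitution `t = β n` moves the parameter from the hyperbolic secant into the Gaussian
density. -/
lemma sechIntegral_scaling (k : ℕ) {β : ℝ} (hβ : 0 < β) :
    ∫ n, n ^ k * (Real.cosh (β * n))⁻¹ ∂gauss
      = (√(2 * Real.pi))⁻¹ * (β⁻¹) ^ (k + 1) * sechIntegral k (1 / (2 * β ^ 2)) := by
  have h := Measure.integral_comp_mul_left (fun t : ℝ =>
    (√(2 * Real.pi))⁻¹ * (β⁻¹) ^ k *
      (t ^ k * Real.exp (-(1 / (2 * β ^ 2)) * t ^ 2) * (Real.cosh t)⁻¹)) β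
  rw [abs_of_pos (inv_pos.2 hβ), smul_eq_mul] at h
  have hR : ∫ t : ℝ, (√(2 * Real.pi))⁻¹ * (β⁻¹) ^ k *
      (t ^ k * Real.exp (-(1 / (2 * β ^ 2)) * t ^ 2) * (Real.cosh t)⁻¹) = _ :=
    integral_const_mul _ _
  rw [hR] at h
  rw [integral_gauss, sechIntegral]
  calc _ = _ := ?_
    _ = _ := h
    _ = _ := by ring
  refine integral_congr_ae (ae_of_all _ fun n => ?_)
  simp only
  have e1 : -(1 / (2 * β ^ 2)) * (β * n) ^ 2 = -n ^ 2 / 2 := by field_simp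
  rw [e1, mul_pow, inv_pow]
  field_simp

/-- Differentiating the Gaussian density instead of `1 / cosh` gives `β K' = L - K`. -/
lemma hasDerivAt_sechMean {β : ℝ} (hβ : 0 < β) :
    HasDerivAt sechMean ((sechSecondMoment β - sechMean β) / β) β := by
  have hK : ∀ b, 0 < b → sechMean b
      = (√(2 * Real.pi))⁻¹ * (b⁻¹ * sechIntegral 0 (1 / (2 * b ^ 2))) := by
    intro b hb
    have := sechIntegral_scaling 0 hb
    simp only [pow_zero, one_mul, zero_add, pow_one] at this
    rw [sechMean, this]; ring
  have hL := sechIntegral_scaling 2 hβ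
  have hev : sechMean =ᶠ[𝓝 β]
      fun b => (√(2 * Real.pi))⁻¹ * (b⁻¹ * sechIntegral 0 (1 / (2 * b ^ 2))) := by
    filter_upwards [lt_mem_nhds hβ] with b hb using hK b hb
  refine HasDerivAt.congr_of_eventuallyEq ?_ hev
  have d1 : HasDerivAt (fun b : ℝ => 1 / (2 * b ^ 2)) (-(1 / β ^ 3)) β := by
    have := ((hasDerivAt_pow 2 β).const_mul 2).inv (by positivity)
    simp only [one_div]
    refine this.congr_deriv ?_
    field_simp
    norm_num
  have d2 : HasDerivAt (fun b : ℝ => sechIntegral 0 (1 / (2 * b ^ 2)))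
      (-sechIntegral 2 (1 / (2 * β ^ 2)) * (-(1 / β ^ 3))) β :=
    HasDerivAt.comp β (hasDerivAt_sechIntegral (by positivity)) d1
  have d3 := ((hasDerivAt_inv hβ.ne').mul d2).const_mul (√(2 * Real.pi))⁻¹
  refine d3.congr_deriv ?_
  rw [sechSecondMoment, hL, hK β hβ, inv_pow]
  field_simp
  ring

/-- `L / K - 1/3 - β²`, whose sign is that of the derivative of the limiting efficiency. -/
noncomputable def slope (β : ℝ) : ℝ := sechSecondMoment β / sechMean β - 1 / 3 - β ^ 2

lemma slope_strictAnti {β₁ β₂ : ℝ} (h1 : 0 ≤ β₁) (h12 : β₁ < β₂) : slope β₂ < slope β₁ := by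
  have h := sechSecondMoment_mul_le h1 h12.le
  have h2 : sechSecondMoment β₂ / sechMean β₂ ≤ sechSecondMoment β₁ / sechMean β₁ := by
    rw [div_le_div_iff₀ (sechMean_pos _) (sechMean_pos _)]; exact h
  have h3 : β₁ ^ 2 < β₂ ^ 2 := pow_lt_pow_left₀ h12 h1 two_ne_zero
  rw [slope, slope]; linarith

lemma limitRate_pos (β : ℝ) : 0 < limitRate β :=
  mul_pos (by positivity) (sechMean_pos β)

lemma hasDerivAt_limitRate {β : ℝ} (hβ : 0 < β) :
    HasDerivAt limitRate (limitRate β * ((slope β - 2 / 3) / β)) β := by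
  have h1 : HasDerivAt (fun b : ℝ => Real.exp (-b ^ 2 / 2) / 2)
      (Real.exp (-β ^ 2 / 2) * (-(2 * β) / 2) / 2) β := by
    have := (((hasDerivAt_pow 2 β).neg.div_const 2).exp).div_const 2
    simpa using this
  have h2 := h1.mul (hasDerivAt_sechMean hβ)
  refine HasDerivAt.congr_deriv (f := limitRate) h2 ?_
  have := (sechMean_pos β).ne'
  rw [limitRate, slope]
  field_simp
  ring

lemma limitRate_antitone : AntitoneOn limitRate (Ici 0) := by
  intro a ha b hb hab
  have ha' : (0 : ℝ) ≤ a := ha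
  rw [limitRate, limitRate]
  refine mul_le_mul ?_ ?_ (sechMean_pos _).le (by positivity)
  · gcongr
  · refine integral_mono (integrable_inv_cosh b) (integrable_inv_cosh a) fun n => ?_
    refine inv_anti₀ (Real.cosh_pos _) ?_
    rw [Real.cosh_le_cosh, abs_mul, abs_mul, abs_of_nonneg ha', abs_of_nonneg (ha'.trans hab)]
    gcongr

/-- The limit of `ESJD_d(h) / d^{2/3}` for `h = ℓ d^{-1/3}`. -/
noncomputable def efficiency (l : ℝ) : ℝ := l * limitRate (l * √l / 8)

lemma hasDerivAt_efficiency {l : ℝ} (hl : 0 < l) :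
    HasDerivAt efficiency (3 / 2 * limitRate (l * √l / 8) * slope (l * √l / 8)) l := by
  have hs := Real.sqrt_pos.2 hl
  have d1 : HasDerivAt (fun l : ℝ => l * √l / 8) ((1 * √l + l * (1 / (2 * √l))) / 8) l :=
    ((hasDerivAt_id l).mul (Real.hasDerivAt_sqrt hl.ne')).div_const 8
  have d2 : HasDerivAt (fun l : ℝ => limitRate (l * √l / 8)) _ l :=
    HasDerivAt.comp l (hasDerivAt_limitRate (by positivity)) d1
  refine HasDerivAt.congr_deriv (f := efficiency) ((hasDerivAt_id l).mul d2) ?_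
  have hq : √l ^ 2 = l := Real.sq_sqrt hl.le
  simp only [id]
  field_simp
  rw [hq]
  ring

end BarkerLangevin

namespace BarkerLangevin

/-! ### Certified bounds for the Gaussian means of the hyperbolic secant -/

/-- The polynomial `e^{-a²/2} E (N^k e^{a N})` in `a`, a Hermite polynomial with positive signs. -/
noncomputable def tiltedMoment : ℕ → ℝ → ℝ
  | 0, _ => 1
  | 1, a => a
  | k + 2, a => a * tiltedMoment (k + 1) a + (k + 1) * tiltedMoment k a

lemma hasDerivAt_tiltedMoment (a : ℝ) : ∀ k : ℕ,
    HasDerivAt (tiltedMoment k) (tiltedMoment (k + 1) a - a * tiltedMoment k a) a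
  | 0 => by
      have h : tiltedMoment 0 = fun _ => (1 : ℝ) := by ext; rw [tiltedMoment]
      rw [h]
      refine (hasDerivAt_const a (1 : ℝ)).congr_deriv ?_
      simp [tiltedMoment]
  | 1 => by
      have h : tiltedMoment 1 = fun a => a := by ext; rw [tiltedMoment]
      rw [h]
      refine (hasDerivAt_id a).congr_deriv ?_
      simp [tiltedMoment]
  | k + 2 => by
      have h : tiltedMoment (k + 2)
          = fun a => a * tiltedMoment (k + 1) a + (k + 1) * tiltedMoment k a := by
        ext; rw [tiltedMoment]
      have h1 := ((hasDerivAt_id a).mul (hasDerivAt_tiltedMoment a (k + 1))).add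
        ((hasDerivAt_tiltedMoment a k).const_mul ((k : ℝ) + 1))
      have e3 : tiltedMoment (k + 2 + 1) a
          = a * tiltedMoment (k + 2) a + ((k : ℝ) + 2) * tiltedMoment (k + 1) a := by
        rw [tiltedMoment]; push_cast; ring
      have e2 : tiltedMoment (k + 1 + 1) a
          = a * tiltedMoment (k + 1) a + ((k : ℝ) + 1) * tiltedMoment k a := by
        rw [tiltedMoment]
      rw [e3, h]
      refine HasDerivAt.congr_deriv (f := fun a => a * tiltedMoment (k + 1) a
        + (k + 1) * tiltedMoment k a) h1 ?_
      rw [e2]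
      simp only [id]
      ring

lemma tiltedMoment_neg (a : ℝ) : ∀ k : ℕ, tiltedMoment k (-a) = (-1) ^ k * tiltedMoment k a
  | 0 => by simp [tiltedMoment]
  | 1 => by simp [tiltedMoment]
  | k + 2 => by
      rw [tiltedMoment, tiltedMoment, tiltedMoment_neg a (k + 1), tiltedMoment_neg a k]; ring

lemma integrable_pow_mul_exp_gauss (k : ℕ) (a : ℝ) :
    Integrable (fun n => n ^ k * Real.exp (a * n)) gauss :=
  integrable_pow_mul_exp_of_mem_interior_integrableExpSet (X := id) (by simp) k

lemma integral_pow_mul_exp_gauss (k : ℕ) (a : ℝ) :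
    ∫ n, n ^ k * Real.exp (a * n) ∂gauss = Real.exp (a ^ 2 / 2) * tiltedMoment k a := by
  induction k generalizing a with
  | zero =>
    have h := congrFun (mgf_id_gaussianReal (μ := 0) (v := 1)) a
    rw [mgf] at h
    simpa [tiltedMoment] using h
  | succ k ih =>
    have h1 := hasDerivAt_integral_pow_mul_exp_real (X := id) (μ := gauss) (t := a) (by simp) k
    simp only [id] at h1
    have h2 : HasDerivAt (fun a => Real.exp (a ^ 2 / 2) * tiltedMoment k a)
        (Real.exp (a ^ 2 / 2) * tiltedMoment (k + 1) a) a := by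
      have := (((hasDerivAt_pow 2 a).div_const 2).exp).mul (hasDerivAt_tiltedMoment a k)
      refine HasDerivAt.congr_deriv (f := fun a => Real.exp (a ^ 2 / 2) * tiltedMoment k a) this ?_
      simp only [Nat.cast_ofNat, Nat.add_one_sub_one, pow_one]
      ring
    have h3 : (fun t => ∫ n, n ^ k * Real.exp (t * n) ∂gauss)
        = fun a => Real.exp (a ^ 2 / 2) * tiltedMoment k a := funext ih
    rw [h3] at h1
    exact h1.unique h2

lemma integrable_pow_mul_cosh_gauss (k : ℕ) (a : ℝ) :
    Integrable (fun n => n ^ k * Real.cosh (a * n)) gauss := by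
  have h := ((integrable_pow_mul_exp_gauss k a).add
    (integrable_pow_mul_exp_gauss k (-a))).div_const 2
  refine h.congr (ae_of_all _ fun n => ?_)
  simp only [Pi.add_apply, Real.cosh_eq, neg_mul]
  ring

lemma integral_pow_mul_cosh_gauss (k : ℕ) (a : ℝ) :
    ∫ n, n ^ (2 * k) * Real.cosh (a * n) ∂gauss
      = Real.exp (a ^ 2 / 2) * tiltedMoment (2 * k) a := by
  have h : ∀ n : ℝ, n ^ (2 * k) * Real.cosh (a * n)
      = (n ^ (2 * k) * Real.exp (a * n) + n ^ (2 * k) * Real.exp (-a * n)) / 2 := by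
    intro n; rw [Real.cosh_eq, neg_mul]; ring
  simp_rw [h]
  rw [integral_div, integral_add (integrable_pow_mul_exp_gauss _ _)
    (integrable_pow_mul_exp_gauss _ _), integral_pow_mul_exp_gauss, integral_pow_mul_exp_gauss,
    tiltedMoment_neg, pow_mul]
  norm_num

/-- The even polynomial `∑_{i < m} a_i n^{2 i}`. -/
noncomputable def evenPoly (a : ℕ → ℝ) (m : ℕ) (n : ℝ) : ℝ :=
  ∑ i ∈ Finset.range m, a i * n ^ (2 * i)

/-- `e^{-b²/2} E (N^{2r} A(N) cosh (b N))` for `A = evenPoly a m`. -/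
noncomputable def linMoment (a : ℕ → ℝ) (m r : ℕ) (b : ℝ) : ℝ :=
  ∑ i ∈ Finset.range m, a i * tiltedMoment (2 * (i + r)) b

/-- `e^{-b²/2} E (N^{2r} A(N)² cosh (b N))` for `A = evenPoly a m`. -/
noncomputable def sqMoment (a : ℕ → ℝ) (m r : ℕ) (b : ℝ) : ℝ :=
  ∑ i ∈ Finset.range m, ∑ j ∈ Finset.range m, a i * a j * tiltedMoment (2 * (i + j + r)) b

section
variable (a : ℕ → ℝ) (m r : ℕ) (b : ℝ)

lemma evenPoly_mul_eq (n : ℝ) : n ^ (2 * r) * evenPoly a m n * Real.cosh (b * n)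
    = ∑ i ∈ Finset.range m, a i * (n ^ (2 * (i + r)) * Real.cosh (b * n)) := by
  rw [evenPoly, Finset.mul_sum, Finset.sum_mul]
  refine Finset.sum_congr rfl fun i _ => ?_
  ring

lemma evenPoly_sq_mul_eq (n : ℝ) : n ^ (2 * r) * evenPoly a m n ^ 2 * Real.cosh (b * n)
    = ∑ i ∈ Finset.range m, ∑ j ∈ Finset.range m,
      a i * a j * (n ^ (2 * (i + j + r)) * Real.cosh (b * n)) := by
  rw [evenPoly, sq, Finset.sum_mul_sum, Finset.mul_sum, Finset.sum_mul]
  refine Finset.sum_congr rfl fun i _ => ?_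
  rw [Finset.mul_sum, Finset.sum_mul]
  refine Finset.sum_congr rfl fun j _ => ?_
  ring

lemma integrable_evenPoly_mul :
    Integrable (fun n => n ^ (2 * r) * evenPoly a m n * Real.cosh (b * n)) gauss := by
  simp_rw [evenPoly_mul_eq]
  exact integrable_finsetSum _ fun i _ => (integrable_pow_mul_cosh_gauss _ b).const_mul _

lemma integrable_evenPoly_sq_mul :
    Integrable (fun n => n ^ (2 * r) * evenPoly a m n ^ 2 * Real.cosh (b * n)) gauss := by
  simp_rw [evenPoly_sq_mul_eq]
  exact integrable_finsetSum _ fun i _ => integrable_finsetSum _ fun j _ =>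
    (integrable_pow_mul_cosh_gauss _ b).const_mul _

lemma integral_evenPoly_mul :
    ∫ n, n ^ (2 * r) * evenPoly a m n * Real.cosh (b * n) ∂gauss
      = Real.exp (b ^ 2 / 2) * linMoment a m r b := by
  simp_rw [evenPoly_mul_eq]
  rw [integral_finsetSum _ fun i _ => (integrable_pow_mul_cosh_gauss _ b).const_mul _, linMoment,
    Finset.mul_sum]
  refine Finset.sum_congr rfl fun i _ => ?_
  rw [integral_const_mul, integral_pow_mul_cosh_gauss]; ring

lemma integral_evenPoly_sq_mul :
    ∫ n, n ^ (2 * r) * evenPoly a m n ^ 2 * Real.cosh (b * n) ∂gauss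
      = Real.exp (b ^ 2 / 2) * sqMoment a m r b := by
  simp_rw [evenPoly_sq_mul_eq]
  rw [integral_finsetSum _ fun i _ => integrable_finsetSum _ fun j _ =>
    (integrable_pow_mul_cosh_gauss _ b).const_mul _, sqMoment, Finset.mul_sum]
  refine Finset.sum_congr rfl fun i _ => ?_
  rw [integral_finsetSum _ fun j _ => (integrable_pow_mul_cosh_gauss _ b).const_mul _,
    Finset.mul_sum]
  refine Finset.sum_congr rfl fun j _ => ?_
  rw [integral_const_mul, integral_pow_mul_cosh_gauss]; ring

/-- `E (N^{2r} (2 A - A² cosh (b N)))`. -/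
noncomputable def sechLower : ℝ :=
  2 * linMoment a m r 0 - Real.exp (b ^ 2 / 2) * sqMoment a m r b

/-- `E (N^{2r} (1 - A cosh (b N))²)`. -/
noncomputable def sechGap : ℝ :=
  tiltedMoment (2 * r) 0 - 2 * (Real.exp (b ^ 2 / 2) * linMoment a m r b)
    + (sqMoment a m r 0 + Real.exp (b ^ 2 / 2) ^ 4 * sqMoment a m r (2 * b)) / 2

lemma integral_sechLower :
    Integrable (fun n => n ^ (2 * r) * (2 * evenPoly a m n
      - evenPoly a m n ^ 2 * Real.cosh (b * n))) gauss ∧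
    ∫ n, n ^ (2 * r) * (2 * evenPoly a m n - evenPoly a m n ^ 2 * Real.cosh (b * n)) ∂gauss
      = sechLower a m r b := by
  have e : ∀ n : ℝ, n ^ (2 * r) * (2 * evenPoly a m n - evenPoly a m n ^ 2 * Real.cosh (b * n))
      = 2 * (n ^ (2 * r) * evenPoly a m n * Real.cosh (0 * n))
        - n ^ (2 * r) * evenPoly a m n ^ 2 * Real.cosh (b * n) := by
    intro n; rw [zero_mul, Real.cosh_zero]; ring
  have i1 := (integrable_evenPoly_mul a m r 0).const_mul 2
  have i2 := integrable_evenPoly_sq_mul a m r b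
  simp_rw [e]
  refine ⟨i1.sub i2, ?_⟩
  rw [integral_sub i1 i2, integral_const_mul, integral_evenPoly_mul, integral_evenPoly_sq_mul,
    sechLower]
  simp

lemma integral_sechGap :
    Integrable (fun n => n ^ (2 * r) * (1 - evenPoly a m n * Real.cosh (b * n)) ^ 2) gauss ∧
    ∫ n, n ^ (2 * r) * (1 - evenPoly a m n * Real.cosh (b * n)) ^ 2 ∂gauss = sechGap a m r b := by
  have e : ∀ n : ℝ, n ^ (2 * r) * (1 - evenPoly a m n * Real.cosh (b * n)) ^ 2
      = n ^ (2 * r) * Real.cosh (0 * n) - 2 * (n ^ (2 * r) * evenPoly a m n * Real.cosh (b * n))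
        + (n ^ (2 * r) * evenPoly a m n ^ 2 * Real.cosh (0 * n)
          + n ^ (2 * r) * evenPoly a m n ^ 2 * Real.cosh (2 * b * n)) / 2 := by
    intro n
    rw [zero_mul, Real.cosh_zero, mul_assoc 2 b n, Real.cosh_two_mul, Real.sinh_sq]
    ring
  have i1 := integrable_pow_mul_cosh_gauss (2 * r) 0
  have i2 := (integrable_evenPoly_mul a m r b).const_mul 2
  have i3 := integrable_evenPoly_sq_mul a m r 0
  have i4 := integrable_evenPoly_sq_mul a m r (2 * b)
  have i12 : Integrable (fun n => n ^ (2 * r) * Real.cosh (0 * n)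
    - 2 * (n ^ (2 * r) * evenPoly a m n * Real.cosh (b * n))) gauss := i1.sub i2
  have i34 : Integrable (fun n => (n ^ (2 * r) * evenPoly a m n ^ 2 * Real.cosh (0 * n)
    + n ^ (2 * r) * evenPoly a m n ^ 2 * Real.cosh (2 * b * n)) / 2) gauss :=
    (i3.add i4).div_const 2
  simp_rw [e]
  refine ⟨i12.add i34, ?_⟩
  rw [integral_add i12 i34, integral_sub i1 i2, integral_div, integral_add i3 i4,
    integral_const_mul, integral_pow_mul_cosh_gauss, integral_evenPoly_mul,
    integral_evenPoly_sq_mul, integral_evenPoly_sq_mul, sechGap, ← Real.exp_nat_mul]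
  have e1 : Real.exp ((2 * b) ^ 2 / 2) = Real.exp ((4 : ℕ) * (b ^ 2 / 2)) := by
    congr 1; push_cast; ring
  rw [e1]
  simp

/-- `1/c = 2A - A² c + (1 - A c)² / c` with `c = cosh (b N) ≥ 1`, for every `A`: an approximation
`A` of `1/c` yields two-sided bounds for the moments of `1/c` with a quadratically small gap. -/
theorem sech_moment_bounds :
    sechLower a m r b ≤ ∫ n, n ^ (2 * r) * (Real.cosh (b * n))⁻¹ ∂gauss ∧
    ∫ n, n ^ (2 * r) * (Real.cosh (b * n))⁻¹ ∂gauss ≤ sechLower a m r b + sechGap a m r b := by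
  obtain ⟨i1, e1⟩ := integral_sechLower a m r b
  obtain ⟨i2, e2⟩ := integral_sechGap a m r b
  have i3 := integrable_pow_mul_inv_cosh (2 * r) b
  have key : ∀ n : ℝ, (Real.cosh (b * n))⁻¹ = 2 * evenPoly a m n
      - evenPoly a m n ^ 2 * Real.cosh (b * n)
      + (1 - evenPoly a m n * Real.cosh (b * n)) ^ 2 * (Real.cosh (b * n))⁻¹ := by
    intro n
    have := (Real.cosh_pos (b * n)).ne'
    field_simp
    ring
  have hp : ∀ n : ℝ, 0 ≤ n ^ (2 * r) := fun n => by rw [pow_mul]; positivity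
  constructor
  · rw [← e1]
    refine integral_mono i1 i3 fun n => mul_le_mul_of_nonneg_left ?_ (hp n)
    rw [key n]
    exact le_add_of_nonneg_right (mul_nonneg (sq_nonneg _) (inv_cosh_pos _).le)
  · rw [← e1, ← e2, ← integral_add i1 i2]
    refine integral_mono i3 (i1.add i2) fun n => ?_
    simp only [← mul_add]
    refine mul_le_mul_of_nonneg_left ?_ (hp n)
    rw [key n]
    gcongr
    exact mul_le_of_le_one_right (sq_nonneg _) (inv_cosh_le_one _)

end

end BarkerLangevin

namespace BarkerLangevin

/-- Coefficients of a weighted least squares approximation of `1 / cosh (0.645 n)`.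
The point `0.645` lies just below the optimal `β`. -/
noncomputable def coefLo : ℕ → ℝ
  | 0 => 0.9837
  | 1 => -0.1599
  | 2 => 0.01136
  | 3 => -0.00027
  | _ => 0

/-- Coefficients of a weighted least squares approximation of
`1 / cosh (0.6467 n)`. The point `0.6467` lies just above the optimal `β`; it is closer to it than
`0.645` is, and needs a higher degree. -/
noncomputable def coefHi : ℕ → ℝ
  | 0 => 0.984932
  | 1 => -0.168115
  | 2 => 0.014446
  | 3 => -0.000573
  | 4 => 0.000008
  | _ => 0

section
variable (a : ℝ)

lemma tiltedMoment_two : tiltedMoment 2 a = a ^ 2 + 1 := by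
  simp [tiltedMoment]; ring

lemma tiltedMoment_zero : tiltedMoment 0 a = 1 := by rw [tiltedMoment]

/-- A two-step recursion through the even indices only. -/
lemma tiltedMoment_add_four (k : ℕ) : tiltedMoment (k + 4) a
    = (a ^ 2 + (2 * k + 5)) * tiltedMoment (k + 2) a
      - (k + 1) * (k + 2) * tiltedMoment k a := by
  have h4 : tiltedMoment (k + 4) a
      = a * tiltedMoment (k + 3) a + ((k : ℝ) + 3) * tiltedMoment (k + 2) a := by
    rw [tiltedMoment]; push_cast; ring
  have h3 : tiltedMoment (k + 3) a
      = a * tiltedMoment (k + 2) a + ((k : ℝ) + 2) * tiltedMoment (k + 1) a := by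
    rw [tiltedMoment]; push_cast; ring
  have h2 : tiltedMoment (k + 2) a
      = a * tiltedMoment (k + 1) a + ((k : ℝ) + 1) * tiltedMoment k a := by
    rw [tiltedMoment]
  rw [h4, h3]
  linear_combination -((k : ℝ) + 2) * h2

lemma tiltedMoment_four : tiltedMoment 4 a =
    a ^ 4 + 6 * a ^ 2 + 3 := by
  rw [tiltedMoment_add_four a 0, tiltedMoment_two, tiltedMoment_zero]; push_cast; ring

lemma tiltedMoment_six : tiltedMoment 6 a =
    a ^ 6 + 15 * a ^ 4 + 45 * a ^ 2 + 15 := by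
  rw [tiltedMoment_add_four a 2, tiltedMoment_four, tiltedMoment_two]; push_cast; ring

lemma tiltedMoment_eight : tiltedMoment 8 a =
    a ^ 8 + 28 * a ^ 6 + 210 * a ^ 4 + 420 * a ^ 2 + 105 := by
  rw [tiltedMoment_add_four a 4, tiltedMoment_six, tiltedMoment_four]; push_cast; ring

lemma tiltedMoment_ten : tiltedMoment 10 a =
    a ^ 10 + 45 * a ^ 8 + 630 * a ^ 6 + 3150 * a ^ 4 + 4725 * a ^ 2 + 945 := by
  rw [tiltedMoment_add_four a 6, tiltedMoment_eight, tiltedMoment_six]; push_cast; ring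

lemma tiltedMoment_twelve : tiltedMoment 12 a =
    a ^ 12 + 66 * a ^ 10 + 1485 * a ^ 8 + 13860 * a ^ 6 + 51975 * a ^ 4 + 62370 * a ^ 2
      + 10395 := by
  rw [tiltedMoment_add_four a 8, tiltedMoment_ten, tiltedMoment_eight]; push_cast; ring

lemma tiltedMoment_fourteen : tiltedMoment 14 a =
    a ^ 14 + 91 * a ^ 12 + 3003 * a ^ 10 + 45045 * a ^ 8 + 315315 * a ^ 6 + 945945 * a ^ 4
      + 945945 * a ^ 2 + 135135 := by
  rw [tiltedMoment_add_four a 10, tiltedMoment_twelve, tiltedMoment_ten]; push_cast; ring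

lemma tiltedMoment_sixteen : tiltedMoment 16 a =
    a ^ 16 + 120 * a ^ 14 + 5460 * a ^ 12 + 120120 * a ^ 10 + 1351350 * a ^ 8 + 7567560 * a ^ 6
      + 18918900 * a ^ 4 + 16216200 * a ^ 2 + 2027025 := by
  rw [tiltedMoment_add_four a 12, tiltedMoment_fourteen, tiltedMoment_twelve]; push_cast; ring

lemma tiltedMoment_eighteen : tiltedMoment 18 a =
    a ^ 18 + 153 * a ^ 16 + 9180 * a ^ 14 + 278460 * a ^ 12 + 4594590 * a ^ 10
      + 41351310 * a ^ 8 + 192972780 * a ^ 6 + 413513100 * a ^ 4 + 310134825 * a ^ 2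
      + 34459425 := by
  rw [tiltedMoment_add_four a 14, tiltedMoment_sixteen, tiltedMoment_fourteen]; push_cast; ring

end

lemma exp_mem_of_partial_sums {x : ℝ} (h0 : 0 ≤ x) (h1 : x ≤ 1) :
    ∑ m ∈ Finset.range 8, x ^ m / m.factorial ≤ Real.exp x ∧
    Real.exp x ≤ ∑ m ∈ Finset.range 8, x ^ m / m.factorial + x ^ 8 * 9 / (40320 * 8) := by
  refine ⟨Real.sum_le_exp_of_nonneg h0 8, (Real.exp_bound' h0 h1 (n := 8) (by norm_num)).trans ?_⟩
  norm_num [Nat.factorial]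

set_option maxHeartbeats 1000000 in
lemma sech_bounds_lo :
    sechMean 0.645 < 2 * 0.3475 * Real.exp (0.645 ^ 2 / 2) ∧
    (1 / 3 + 0.645 ^ 2) * sechMean 0.645 < sechSecondMoment 0.645 := by
  obtain ⟨l0, u0⟩ := sech_moment_bounds coefLo 4 0 0.645
  obtain ⟨l1, u1⟩ := sech_moment_bounds coefLo 4 1 0.645
  obtain ⟨x0, x1⟩ := exp_mem_of_partial_sums (x := 0.645 ^ 2 / 2) (by norm_num) (by norm_num)
  have eK : ∫ n, n ^ (2 * 0) * (Real.cosh (0.645 * n))⁻¹ ∂gauss = sechMean 0.645 := by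
    simp [sechMean]
  have eL : ∫ n, n ^ (2 * 1) * (Real.cosh (0.645 * n))⁻¹ ∂gauss = sechSecondMoment 0.645 := rfl
  rw [eK, sechLower] at l0 u0
  rw [eL, sechLower] at l1 u1
  rw [sechGap] at u0 u1
  have X0 : 1.2312285 ≤ Real.exp (0.645 ^ 2 / 2) := by
    refine le_trans ?_ x0
    norm_num [Finset.sum_range_succ, Nat.factorial]
  have X1 : Real.exp (0.645 ^ 2 / 2) ≤ 1.2312286 := by
    refine x1.trans ?_
    norm_num [Finset.sum_range_succ, Nat.factorial]
  generalize Real.exp (0.645 ^ 2 / 2) = X at *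
  have Y0 : 2.298024 ≤ X ^ 4 := le_trans (by norm_num) (pow_le_pow_left₀ (by norm_num) X0 4)
  have Y1 : X ^ 4 ≤ 2.298026 := (pow_le_pow_left₀ (by linarith) X1 4).trans (by norm_num)
  generalize X ^ 4 = Y at *
  -- The bounds are now linear in `X` and `Y`, with rational coefficients.
  clear x0 x1 eK eL
  norm_num [linMoment, sqMoment, Finset.sum_range_succ, coefLo, tiltedMoment_zero,
    tiltedMoment_two, tiltedMoment_four, tiltedMoment_six, tiltedMoment_eight,
    tiltedMoment_ten, tiltedMoment_twelve, tiltedMoment_fourteen,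
    tiltedMoment_sixteen, tiltedMoment_eighteen] at l0 u0 l1 u1
  constructor <;> linarith

set_option maxHeartbeats 1000000 in
lemma sech_bounds_hi :
    2 * 0.3465 * Real.exp (0.6467 ^ 2 / 2) < sechMean 0.6467 ∧
    sechSecondMoment 0.6467 < (1 / 3 + 0.6467 ^ 2) * sechMean 0.6467 := by
  obtain ⟨l0, u0⟩ := sech_moment_bounds coefHi 5 0 0.6467
  obtain ⟨l1, u1⟩ := sech_moment_bounds coefHi 5 1 0.6467
  obtain ⟨x0, x1⟩ := exp_mem_of_partial_sums (x := 0.6467 ^ 2 / 2) (by norm_num) (by norm_num)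
  have eK : ∫ n, n ^ (2 * 0) * (Real.cosh (0.6467 * n))⁻¹ ∂gauss = sechMean 0.6467 := by
    simp [sechMean]
  have eL : ∫ n, n ^ (2 * 1) * (Real.cosh (0.6467 * n))⁻¹ ∂gauss = sechSecondMoment 0.6467 := rfl
  rw [eK, sechLower] at l0 u0
  rw [eL, sechLower] at l1 u1
  rw [sechGap] at u0 u1
  have X0 : 1.2325811 ≤ Real.exp (0.6467 ^ 2 / 2) := by
    refine le_trans ?_ x0
    norm_num [Finset.sum_range_succ, Nat.factorial]
  have X1 : Real.exp (0.6467 ^ 2 / 2) ≤ 1.2325812 := by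
    refine x1.trans ?_
    norm_num [Finset.sum_range_succ, Nat.factorial]
  generalize Real.exp (0.6467 ^ 2 / 2) = X at *
  have Y0 : 2.308139 ≤ X ^ 4 := le_trans (by norm_num) (pow_le_pow_left₀ (by norm_num) X0 4)
  have Y1 : X ^ 4 ≤ 2.308141 := (pow_le_pow_left₀ (by linarith) X1 4).trans (by norm_num)
  generalize X ^ 4 = Y at *
  -- The bounds are now linear in `X` and `Y`, with rational coefficients.
  clear x0 x1 eK eL
  norm_num [linMoment, sqMoment, Finset.sum_range_succ, coefHi, tiltedMoment_zero,
    tiltedMoment_two, tiltedMoment_four, tiltedMoment_six, tiltedMoment_eight,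
    tiltedMoment_ten, tiltedMoment_twelve, tiltedMoment_fourteen,
    tiltedMoment_sixteen, tiltedMoment_eighteen] at l0 u0 l1 u1
  constructor <;> linarith

end BarkerLangevin

namespace BarkerLangevin

/-! ### The maximiser of the limiting efficiency -/

lemma limitRate_lo : limitRate 0.645 < 0.3475 := by
  have h := sech_bounds_lo.1
  rw [limitRate, neg_div, Real.exp_neg]
  have := Real.exp_pos ((0.645 : ℝ) ^ 2 / 2)
  rw [div_mul_eq_mul_div, div_lt_iff₀ two_pos, inv_mul_lt_iff₀ this]
  linarith

lemma limitRate_hi : 0.3465 < limitRate 0.6467 := by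
  have h := sech_bounds_hi.1
  rw [limitRate, neg_div, Real.exp_neg]
  have := Real.exp_pos ((0.6467 : ℝ) ^ 2 / 2)
  rw [div_mul_eq_mul_div, lt_div_iff₀ two_pos, lt_inv_mul_iff₀ this]
  linarith

lemma slope_lo : 0 < slope 0.645 := by
  have h := sech_bounds_lo.2
  rw [slope, sub_sub, sub_pos, lt_div_iff₀ (sechMean_pos _)]; exact h

lemma slope_hi : slope 0.6467 < 0 := by
  have h := sech_bounds_hi.2
  rw [slope, sub_sub, sub_neg, div_lt_iff₀ (sechMean_pos _)]; exact h

lemma mul_sqrt_lt {a b : ℝ} (ha : 0 ≤ a) (hab : a < b) : a * √a / 8 < b * √b / 8 := by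
  have h1 : √a ≤ √b := Real.sqrt_le_sqrt hab.le
  have h2 : 0 < √b := Real.sqrt_pos.2 (ha.trans_lt hab)
  have : a * √a ≤ a * √b := mul_le_mul_of_nonneg_left h1 ha
  have : a * √b < b * √b := mul_lt_mul_of_pos_right hab h2
  linarith

lemma exists_mul_sqrt_eq {β : ℝ} (hβ : 0 < β) : ∃ l : ℝ, 0 < l ∧ l * √l / 8 = β := by
  refine ⟨4 * β ^ (2 / 3 : ℝ), by positivity, ?_⟩
  have e : √(4 * β ^ (2 / 3 : ℝ)) = 2 * β ^ (1 / 3 : ℝ) := by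
    have : 4 * β ^ (2 / 3 : ℝ) = (2 * β ^ (1 / 3 : ℝ)) ^ 2 := by
      rw [mul_pow, ← Real.rpow_natCast (β ^ (1 / 3 : ℝ)), ← Real.rpow_mul hβ.le]; norm_num
    rw [this, Real.sqrt_sq (by positivity)]
  rw [e]
  calc _ = β ^ (2 / 3 : ℝ) * β ^ (1 / 3 : ℝ) := by ring
    _ = β := by rw [← Real.rpow_add hβ]; norm_num

lemma efficiency_pos {l : ℝ} (hl : 0 < l) : 0 < efficiency l := mul_pos hl (limitRate_pos _)

/-- The limiting efficiency has a critical point, where the acceptance rate is `0.347` to three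
decimals; it increases strictly before it and decreases strictly after it. -/
lemma exists_optimal_efficiency : ∃ c : ℝ, 0 < c ∧ |limitRate (c * √c / 8) - 0.347| < 0.0005 ∧
    StrictMonoOn efficiency (Ioc 0 c) ∧ StrictAntiOn efficiency (Ici c) := by
  obtain ⟨l₁, hl₁, e₁⟩ := exists_mul_sqrt_eq (β := 0.645) (by norm_num)
  obtain ⟨l₂, hl₂, e₂⟩ := exists_mul_sqrt_eq (β := 0.6467) (by norm_num)
  have h12 : l₁ < l₂ := by
    by_contra hc
    rcases (not_lt.1 hc).eq_or_lt with h | h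
    · rw [h, e₁] at e₂; norm_num at e₂
    · have := mul_sqrt_lt hl₂.le h
      rw [e₁, e₂] at this; norm_num at this
  obtain ⟨c, hc, hc0⟩ := exists_hasDerivWithinAt_eq_of_lt_of_gt h12.le
    (f := efficiency) (f' := fun l => 3 / 2 * limitRate (l * √l / 8) * slope (l * √l / 8)) (m := 0)
    (fun l hl => (hasDerivAt_efficiency (hl₁.trans_le hl.1)).hasDerivWithinAt)
    (by
      simp only [e₁]
      exact mul_pos (mul_pos (by norm_num) (limitRate_pos _)) slope_lo)
    (by
      simp only [e₂]
      exact mul_neg_of_pos_of_neg (mul_pos (by norm_num) (limitRate_pos _)) slope_hi)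
  have hcpos : 0 < c := hl₁.trans hc.1
  have hslope : slope (c * √c / 8) = 0 := by
    have := limitRate_pos (c * √c / 8)
    rcases mul_eq_zero.1 hc0 with h | h
    · exact absurd h (by positivity)
    · exact h
  refine ⟨c, hcpos, ?_, ?_, ?_⟩
  · have b1 : (0.645 : ℝ) < c * √c / 8 := e₁ ▸ mul_sqrt_lt hl₁.le hc.1
    have b2 : c * √c / 8 < 0.6467 := e₂ ▸ mul_sqrt_lt hcpos.le hc.2
    have a1 := limitRate_antitone (a := 0.645) (by norm_num [mem_Ici]) (by
      rw [mem_Ici]; positivity) b1.le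
    have a2 := limitRate_antitone (b := 0.6467) (by
      rw [mem_Ici]; positivity) (by norm_num [mem_Ici]) b2.le
    have := limitRate_lo
    have := limitRate_hi
    rw [abs_lt]; constructor <;> linarith
  · refine strictMonoOn_of_deriv_pos (convex_Ioc 0 c)
      (fun l hl => (hasDerivAt_efficiency hl.1).continuousAt.continuousWithinAt) fun l hl => ?_
    rw [interior_Ioc] at hl
    rw [(hasDerivAt_efficiency hl.1).deriv]
    have h1 : 0 ≤ l * √l / 8 := by have := hl.1; positivity
    have := slope_strictAnti h1 (mul_sqrt_lt hl.1.le hl.2)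
    exact mul_pos (mul_pos (by norm_num) (limitRate_pos _)) (by linarith)
  · refine strictAntiOn_of_deriv_neg (convex_Ici c)
      (fun l hl => (hasDerivAt_efficiency (hcpos.trans_le hl)).continuousAt.continuousWithinAt)
      fun l hl => ?_
    rw [interior_Ici] at hl
    have hl0 : 0 < l := hcpos.trans hl
    rw [(hasDerivAt_efficiency hl0).deriv]
    have h1 : 0 ≤ c * √c / 8 := by positivity
    have := slope_strictAnti h1 (mul_sqrt_lt hcpos.le hl)
    exact mul_neg_of_pos_of_neg (mul_pos (by norm_num) (limitRate_pos _)) (by linarith)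

/-! ### Convergence of the optimal step sizes and acceptance rates -/

/-- `d^{-1/6}`, the small parameter in which all errors are polynomial: step sizes of the optimal
order are `h = ℓ t²`. -/
noncomputable def smallParam (d : ℕ) : ℝ := (d : ℝ) ^ (-(1 / 6) : ℝ)

lemma smallParam_pos {d : ℕ} (hd : 1 ≤ d) : 0 < smallParam d :=
  Real.rpow_pos_of_pos (by exact_mod_cast hd) _

lemma tendsto_smallParam : Tendsto smallParam atTop (𝓝 0) :=
  (tendsto_rpow_neg_atTop (by norm_num : (0 : ℝ) < 1 / 6)).comp tendsto_natCast_atTop_atTop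

lemma sqrt_eq_smallParam {d : ℕ} (hd : 1 ≤ d) : √(d : ℝ) = (smallParam d ^ 3)⁻¹ := by
  have hd0 : (0 : ℝ) < d := by exact_mod_cast hd
  rw [smallParam, ← Real.rpow_natCast, ← Real.rpow_mul hd0.le, ← Real.rpow_neg hd0.le,
    Real.sqrt_eq_rpow]
  norm_num

lemma cast_eq_smallParam {d : ℕ} (hd : 1 ≤ d) : (d : ℝ) = (smallParam d ^ 6)⁻¹ := by
  rw [← Real.sq_sqrt (Nat.cast_nonneg d), sqrt_eq_smallParam hd]; ring

lemma rpow_third_mul_smallParam {d : ℕ} (hd : 1 ≤ d) :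
    (d : ℝ) ^ (1 / 3 : ℝ) * smallParam d ^ 2 = 1 := by
  have hd0 : (0 : ℝ) < d := by exact_mod_cast hd
  rw [smallParam, ← Real.rpow_natCast, ← Real.rpow_mul hd0.le, ← Real.rpow_add hd0]
  norm_num

section
variable {d : ℕ} {κ l L t : ℝ}

lemma sqrt_step (hl : 0 < l) (ht : 0 < t) : √(l * t ^ 2) = √l * t := by
  rw [Real.sqrt_mul hl.le, Real.sqrt_sq ht.le]

lemma scale_eq (hd : 1 ≤ d) (hl : 0 < l) : scale d (l * smallParam d ^ 2) = l * √l / 8 := by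
  have ht := smallParam_pos hd
  rw [scale, sqrt_step hl ht, sqrt_eq_smallParam hd]
  field_simp

/-- The error of the acceptance rate at `h = ℓ t²`. -/
noncomputable def acceptError (κ l t : ℝ) : ℝ :=
  κ * (l ^ 2 * t / 4 + l ^ 3 * t ^ 3 / 32) + l * √l / 4 * (κ * t ^ 3 + l * t ^ 2 / 2)

/-- The error of `ESJD_d(h) / d^{2/3}` at `h = ℓ t²`. -/
noncomputable def jumpError (κ l t : ℝ) : ℝ :=
  l ^ 2 * t ^ 2 / 4 + l * √l * t ^ 4 + κ * l * t ^ 3 + l * acceptError κ l t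

lemma acceptError_nonneg (hκ : 0 ≤ κ) (hl : 0 ≤ l) (ht : 0 ≤ t) : 0 ≤ acceptError κ l t := by
  rw [acceptError]; positivity

lemma acceptError_mono (hκ : 0 ≤ κ) (hl : 0 ≤ l) (ht : 0 ≤ t) (hL : l ≤ L) :
    acceptError κ l t ≤ acceptError κ L t := by
  rw [acceptError, acceptError]
  have := hl.trans hL
  gcongr

lemma jumpError_mono (hκ : 0 ≤ κ) (hl : 0 ≤ l) (ht : 0 ≤ t) (hL : l ≤ L) :
    jumpError κ l t ≤ jumpError κ L t := by
  rw [jumpError, jumpError]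
  have h0 := hl.trans hL
  have h1 := acceptError_nonneg hκ hl ht
  have h2 := acceptError_mono hκ hl ht hL
  gcongr

lemma tendsto_acceptError (κ l : ℝ) :
    Tendsto (fun d => acceptError κ l (smallParam d)) atTop (𝓝 0) := by
  have hc : Continuous (acceptError κ l) := by unfold acceptError; fun_prop
  have := (hc.tendsto 0).comp tendsto_smallParam
  simpa [acceptError, Function.comp_def] using this

lemma tendsto_jumpError (κ l : ℝ) :
    Tendsto (fun d => jumpError κ l (smallParam d)) atTop (𝓝 0) := by
  have hc : Continuous (jumpError κ l) := by unfold jumpError acceptError; fun_prop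
  have := (hc.tendsto 0).comp tendsto_smallParam
  simpa [jumpError, acceptError, Function.comp_def] using this

lemma rateError_eq (hd : 1 ≤ d) (hl : 0 < l) :
    rateError κ d (l * smallParam d ^ 2) = acceptError κ l (smallParam d) := by
  have ht := smallParam_pos hd
  rw [rateError, acceptError, sqrt_step hl ht, sqrt_eq_smallParam hd]
  field_simp

lemma abs_meanAccept_sub_limitRate_le (hκ : ∀ d : ℕ,
    ∫ x, |‖x‖ ^ 2 - d| ∂(stdGaussian (Euc d)) ≤ κ * √d) (hd : 1 ≤ d) (hl : 0 < l) :
    |meanAccept d (l * smallParam d ^ 2) - limitRate (l * √l / 8)|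
      ≤ acceptError κ l (smallParam d) := by
  have ht := smallParam_pos hd
  have h := abs_meanAccept_sub_le hκ hd (h := l * smallParam d ^ 2) (by positivity)
  rwa [scale_eq hd hl, rateError_eq hd hl] at h

lemma abs_meanJump_sub_efficiency_le (hκ : ∀ d : ℕ,
    ∫ x, |‖x‖ ^ 2 - d| ∂(stdGaussian (Euc d)) ≤ κ * √d) (hd : 1 ≤ d) (hl : 0 < l) :
    |smallParam d ^ 4 * meanJump d (l * smallParam d ^ 2) - efficiency l|
      ≤ jumpError κ l (smallParam d) := by
  have ht := smallParam_pos hd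
  have h := abs_meanJump_sub_le hκ hd (h := l * smallParam d ^ 2) (by positivity)
  rw [scale_eq hd hl, rateError_eq hd hl, sqrt_step hl ht, sqrt_eq_smallParam hd,
    cast_eq_smallParam hd] at h
  set t := smallParam d
  have e : t ^ 4 * meanJump d (l * t ^ 2) - efficiency l = t ^ 4 *
      (meanJump d (l * t ^ 2) - l * t ^ 2 * (t ^ 6)⁻¹ * limitRate (l * √l / 8)) := by
    rw [efficiency]; field_simp
  rw [e, abs_mul, abs_of_pos (by positivity)]
  refine (mul_le_mul_of_nonneg_left h (by positivity)).trans_eq ?_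
  rw [jumpError]
  field_simp

/-- The tail bound at `h = ℓ d^{-1/3}`, uniform in `d`; it keeps the scaled maximisers bounded. -/
lemma meanJump_le_inv_sqrt (hd : 1 ≤ d) (hl : 0 < l) :
    smallParam d ^ 4 * meanJump d (l * smallParam d ^ 2) ≤ 64 / √l := by
  have ht := smallParam_pos hd
  have h := meanJump_le_div d (h := l * smallParam d ^ 2) (by positivity)
  rw [sqrt_step hl ht, sqrt_eq_smallParam hd] at h
  refine (mul_le_mul_of_nonneg_left h (by positivity)).trans_eq ?_
  have := Real.sqrt_pos.2 hl
  field_simp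

end

/-- Maximisers of `ESJD_d` scale as `c d^{-1/3}`: the scaled step sizes stay bounded by the tail
estimate, on bounded sets `ESJD_d / d^{2/3}` is uniformly close to the limiting efficiency, and the
latter exceeds its values away from `c` by a fixed amount. -/
theorem tendsto_of_isMaxOn {c κ : ℝ} (hκ0 : 0 ≤ κ) (hκ : ∀ d : ℕ,
    ∫ x, |‖x‖ ^ 2 - d| ∂(stdGaussian (Euc d)) ≤ κ * √d) (hc : 0 < c)
    (hmono : StrictMonoOn efficiency (Ioc 0 c)) (hanti : StrictAntiOn efficiency (Ici c))
    {h : ℕ → ℝ} (hh : ∀ᶠ d in atTop, 0 < h d ∧ IsMaxOn (meanJump d) (Ioi 0) (h d)) :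
    Tendsto (fun d : ℕ => h d * (d : ℝ) ^ (1 / 3 : ℝ)) atTop (𝓝 c) ∧
    Tendsto (fun d : ℕ => meanAccept d (h d)) atTop (𝓝 (limitRate (c * √c / 8))) := by
  set l : ℕ → ℝ := fun d => h d * (d : ℝ) ^ (1 / 3 : ℝ) with hl
  have hev : ∀ᶠ d in atTop, 1 ≤ d ∧ 0 < l d ∧ h d = l d * smallParam d ^ 2 ∧
      IsMaxOn (meanJump d) (Ioi 0) (h d) := by
    filter_upwards [hh, eventually_ge_atTop 1] with d h1 hd
    have hd0 : (0 : ℝ) < d := by exact_mod_cast hd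
    refine ⟨hd, mul_pos h1.1 (Real.rpow_pos_of_pos hd0 _), ?_, h1.2⟩
    rw [hl, mul_assoc, rpow_third_mul_smallParam hd, mul_one]
  have hm := efficiency_pos hc
  set L : ℝ := (128 / efficiency c) ^ 2 with hL
  -- Maximality, compared with the step size `c t²`.
  have hcomp : ∀ᶠ d in atTop, efficiency c - jumpError κ c (smallParam d)
      ≤ smallParam d ^ 4 * meanJump d (l d * smallParam d ^ 2) := by
    filter_upwards [hev] with d ⟨hd, _, he, hmax⟩
    have ht := smallParam_pos hd
    have h1 := abs_le.1 (abs_meanJump_sub_efficiency_le hκ hd hc)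
    have h2 : meanJump d (c * smallParam d ^ 2) ≤ meanJump d (h d) :=
      hmax (show 0 < c * smallParam d ^ 2 by positivity)
    rw [← he]
    have := mul_le_mul_of_nonneg_left h2 (by positivity : 0 ≤ smallParam d ^ 4)
    linarith [h1.1]
  have hbdd : ∀ᶠ d in atTop, l d ≤ L := by
    filter_upwards [hev, hcomp, (tendsto_jumpError κ c).eventually_lt_const
      (half_pos hm)] with d ⟨hd, hl0, _, _⟩ h1 h2
    have h3 := h1.trans (meanJump_le_inv_sqrt hd hl0)
    have hs := Real.sqrt_pos.2 hl0
    have h4 : efficiency c / 2 ≤ 64 / √(l d) := by linarith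
    rw [le_div_iff₀ hs] at h4
    have h5 : √(l d) ≤ 128 / efficiency c := by rw [le_div_iff₀ hm]; linarith
    calc l d = √(l d) ^ 2 := (Real.sq_sqrt hl0.le).symm
      _ ≤ L := by rw [hL]; gcongr
  have hlow : ∀ᶠ d in atTop, efficiency c
      - (jumpError κ c (smallParam d) + jumpError κ L (smallParam d)) ≤ efficiency (l d) := by
    filter_upwards [hev, hcomp, hbdd] with d ⟨hd, hl0, _, _⟩ h1 h2
    have h3 := abs_le.1 (abs_meanJump_sub_efficiency_le hκ hd hl0)
    have h4 := jumpError_mono hκ0 hl0.le (smallParam_pos hd).le h2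
    linarith [h3.2]
  have hlim : Tendsto l atTop (𝓝 c) := by
    have hnear : ∀ m < efficiency c, ∀ᶠ d in atTop, m < efficiency (l d) := by
      intro m hmc
      have h0 := (tendsto_jumpError κ c).add (tendsto_jumpError κ L)
      rw [add_zero] at h0
      filter_upwards [hlow, h0.eventually_lt_const (sub_pos.2 hmc)] with d h1 h2
      linarith
    rw [tendsto_order]
    constructor
    · intro x hx
      rcases le_or_gt x 0 with hx0 | hx0
      · filter_upwards [hev] with d h1 using hx0.trans_lt h1.2.1
      · filter_upwards [hev, hnear _ (hmono ⟨hx0, hx.le⟩ ⟨hc, le_rfl⟩ hx)] with d h1 h2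
        by_contra hcon
        exact absurd (hmono.monotoneOn ⟨h1.2.1, (not_lt.1 hcon).trans hx.le⟩ ⟨hx0, hx.le⟩
          (not_lt.1 hcon)) (not_le.2 h2)
    · intro x hx
      filter_upwards [hnear _ (hanti (mem_Ici.2 le_rfl) (mem_Ici.2 hx.le) hx)] with d h2
      by_contra hcon
      exact absurd (hanti.antitoneOn (mem_Ici.2 hx.le) (mem_Ici.2 (hx.le.trans (not_lt.1 hcon)))
        (not_lt.1 hcon)) (not_le.2 h2)
  refine ⟨hlim, ?_⟩
  have hcont : ContinuousAt (fun l => limitRate (l * √l / 8)) c := by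
    have h1 : ContinuousAt (fun l : ℝ => l * √l / 8) c := by fun_prop
    have hs := Real.sqrt_pos.2 hc
    exact ContinuousAt.comp (g := limitRate) (f := fun l : ℝ => l * √l / 8)
      (hasDerivAt_limitRate (by positivity)).continuousAt h1
  have h1 : Tendsto (fun d => limitRate (l d * √(l d) / 8)) atTop (𝓝 (limitRate (c * √c / 8))) :=
    hcont.tendsto.comp hlim
  have h2 : Tendsto (fun d => meanAccept d (h d) - limitRate (l d * √(l d) / 8)) atTop (𝓝 0) := by
    refine squeeze_zero_norm' ?_ (tendsto_acceptError κ L)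
    filter_upwards [hev, hbdd] with d ⟨hd, hl0, he, _⟩ hb
    rw [Real.norm_eq_abs, he]
    exact (abs_meanAccept_sub_limitRate_le hκ hd hl0).trans
      (acceptError_mono hκ0 hl0.le (smallParam_pos hd).le hb)
  simpa using h2.add h1

end BarkerLangevin

theorem mainTheorem7 :
    ∃ c a : ℝ, 0 < c ∧ |a - 0.347| < 0.0005 ∧
      ∀ (s : ∀ d : ℕ, BarkerLangevin.Euc d → BarkerLangevin.Euc d)
        (C : ∀ d : ℕ, BarkerLangevin.Euc d → BarkerLangevin.Euc d → ℝ),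
        (∀ d, BarkerLangevin.IsExactScore (BarkerLangevin.stdDensity d) (s d)) →
        (∀ d, BarkerLangevin.IsScoreBound (s d) (C d)) →
        (∀ d, ∃ h, BarkerLangevin.IsOptimalStep (BarkerLangevin.stdDensity d) (s d) (C d) h) ∧
        ∀ h : ℕ → ℝ,
          (∀ᶠ d in atTop,
            BarkerLangevin.IsOptimalStep (BarkerLangevin.stdDensity d) (s d) (C d) (h d)) →
          Tendsto (fun d : ℕ => h d * (d : ℝ) ^ (1 / 3 : ℝ)) atTop (𝓝 c) ∧
          Tendsto (fun d : ℕ => BarkerLangevin.acceptanceRate (BarkerLangevin.stdDensity d)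
            (s d) (C d) (h d)) atTop (𝓝 a) := by
  obtain ⟨c, hc, ha, hmono, hanti⟩ := BarkerLangevin.exists_optimal_efficiency
  obtain ⟨κ, hκ0, hκ⟩ := BarkerLangevin.exists_integral_abs_norm_sq_sub_le
  refine ⟨c, _, hc, ha, fun s C hs hC => ?_⟩
  have hneg := fun d => (hs d).eq_neg
  refine ⟨fun d => ?_, fun h hopt => ?_⟩
  · obtain ⟨h, hh⟩ := BarkerLangevin.exists_isMaxOn_meanJump d
    exact ⟨h, (BarkerLangevin.isOptimalStep_iff (hneg d) (hC d) h).2 hh⟩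
  · have hmax := hopt.mono fun d hd =>
      (BarkerLangevin.isOptimalStep_iff (hneg d) (hC d) (h d)).1 hd
    obtain ⟨h1, h2⟩ := BarkerLangevin.tendsto_of_isMaxOn hκ0 hκ hc hmono hanti hmax
    refine ⟨h1, h2.congr' ?_⟩
    filter_upwards [hmax] with d hd
    exact (BarkerLangevin.acceptanceRate_eq (hneg d) (hC d) hd.1).symm
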